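/- An instance of the Uniform Cost-Distance Steiner Tree Problem consists of a metric space $(M,c)$, a root $r$, a finite set $T$ of sinks, a map $p\colon T\mathbin{\dot\cup}\{r\}\to M$, and delay weights $w\colon T\to\mathbb{R}_{\ge 0}$. A Steiner tree for $T\cup\{r\}$ is a finite tree $A$ with $T\cup\{r\}\subseteq V(A)$ together with an extension of $p$ to a map $p\colon V(A)\to M$. Write $c(x,y)$ for $c(p(x),p(y))$. The length (connection cost) of $A$ is $\sum_{\{x,y\}\in E(A)} c(x,y)$, and its objective value is $$\sum_{\{x,y\}\in E(A)} c(x,y)+\sum_{t\in T} w(t)\sum_{\{x,y\}\in E(A_{[r,t]})} c(x,y),$$ where $A_{[r,t]}$ is the unique $r$-$t$-path in $A$. A Steiner tree is $\beta$-approximate if its length is at most $\beta$ times the length of every Steiner tree for $T\cup\{r\}$. Put $$D=\sum_{t\in T} w(t)\,c(r,t)\qquad\text{and}\qquad b=\frac{1609\sqrt{1609}-42427}{34992}\approx 0.632 .$$ The model of computation is a real RAM. It has arrays of natural numbers (with addition, truncated subtraction, comparison and indirect addressing), of real numbers (with the field operations, comparison and rational constants) and of points of $M$ (which can be copied). Each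 such elementary operation, and each evaluation of the metric $c$, takes constant time. The machine may also call an arbitrary subroutine that returns, on the given instance, a $\beta$-approximate minimum-length Steiner tree for $T\cup\{r\}$ as a list of its edges (in any order) together with the positions of its vertices. A call takes time $\Lambda$, the running time of the subroutine, which is at least the number of vertices of the tree that it writes down. **Theorem.** There are a single program and an absolute constant $K$ such that, for every instance $(M,c,r,T,p,w)$ of the Uniform Cost-Distance Steiner Tree Problem, every real threshold $\mu>0$, every $\beta$ and every $\beta$-approximate Steiner tree subroutine, the following holds. Given the instance and $\mu$, the program halts after at most $K\,(\Lambda+|T|)$ steps and outputs a Steiner tree for $T\cup\{r\}$ (as a list of its edges together with the positions of its vertices) whose objective value is at most $$(1+b\mu)\,C+\Bigl(1+\frac1\mu\Bigr)D,$$ where $C$ is the length of the $\beta$-approximate Steiner tree returned by the subroutine. -/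

import Mathlib

open scoped NNReal

namespace CostDistance

universe u

/-- An instance of the Uniform Cost-Distance Steiner Tree Problem in the space `M`, whose distance
`dist` is the cost function `c`.  The sinks are numbered `0, …, numSinks - 1`; `rootPos` and
`sinkPos` are the map `p` on the root and on the sinks. -/
structure Problem (M : Type u) where
  numSinks : ℕ
  rootPos : M
  sinkPos : Fin numSinks → M
  weight : Fin numSinks → ℝ≥0

/-- A Steiner tree for the root and the sinks.  Its vertices are numbered: `0` is the root, `t + 1`
is the sink `t`, and the remaining `numSteiner` vertices are Steiner vertices. -/
structure SteinerTree {M : Type u} (I : Problem M) where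
  numSteiner : ℕ
  graph : SimpleGraph (Fin (I.numSinks + numSteiner + 1))
  isTree : graph.IsTree
  pos : Fin (I.numSinks + numSteiner + 1) → M
  pos_root : pos 0 = I.rootPos
  pos_sink : ∀ t : Fin I.numSinks, pos ⟨t + 1, by omega⟩ = I.sinkPos t

namespace SteinerTree

variable {M : Type u} {I : Problem M}

/-- The vertex type of a Steiner tree. -/
abbrev Vertex (A : SteinerTree I) : Type := Fin (I.numSinks + A.numSteiner + 1)

/-- The root as a vertex. -/
def root (A : SteinerTree I) : A.Vertex := 0

/-- The sink `t` as a vertex. -/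
def sink (A : SteinerTree I) (t : Fin I.numSinks) : A.Vertex := ⟨t + 1, by omega⟩

variable [PseudoMetricSpace M]

/-- The length `c(p(x), p(y))` of the pair `{x, y}`. -/
noncomputable def edgeLength (A : SteinerTree I) : Sym2 A.Vertex → ℝ :=
  Sym2.lift ⟨fun x y => dist (A.pos x) (A.pos y), fun _ _ => dist_comm _ _⟩

open Classical in
/-- The connection cost (the length) of a Steiner tree. -/
noncomputable def connectionCost (A : SteinerTree I) : ℝ :=
  ∑ e ∈ A.graph.edgeFinset, A.edgeLength e

/-- The length of the unique path of the tree between `x` and `y`. -/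
noncomputable def pathLength (A : SteinerTree I) (x y : A.Vertex) : ℝ :=
  ((A.isTree.existsUnique_path x y).choose.edges.map A.edgeLength).sum

/-- The delay cost: the weighted sum of the lengths of the root-sink paths. -/
noncomputable def delayCost (A : SteinerTree I) : ℝ :=
  ∑ t : Fin I.numSinks, (I.weight t : ℝ) * A.pathLength A.root (A.sink t)

/-- The objective value: connection cost plus delay cost. -/
noncomputable def objective (A : SteinerTree I) : ℝ :=
  A.connectionCost + A.delayCost

/-- `A` is a `β`-approximate minimum-length Steiner tree. -/
def IsApprox (A : SteinerTree I) (β : ℝ) : Prop :=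
  ∀ B : SteinerTree I, A.connectionCost ≤ β * B.connectionCost

end SteinerTree

/-- The minimum possible delay cost `D = ∑ t, w(t) c(r, t)`. -/
noncomputable def Problem.minDelay {M : Type u} [PseudoMetricSpace M] (I : Problem M) : ℝ :=
  ∑ t : Fin I.numSinks, (I.weight t : ℝ) * dist I.rootPos (I.sinkPos t)

/-- A list of the edges of a Steiner tree, in any order and with the two ends of each edge in any
order.  A tree with `numSinks + numSteiner + 1` vertices has `numSinks + numSteiner` edges, so every
edge is listed exactly once. -/
structure EdgeList {M : Type u} {I : Problem M} (A : SteinerTree I) where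
  left : Fin (I.numSinks + A.numSteiner) → A.Vertex
  right : Fin (I.numSinks + A.numSteiner) → A.Vertex
  adj_iff : ∀ x y : A.Vertex, A.graph.Adj x y ↔
    ∃ i, (left i = x ∧ right i = y) ∨ (left i = y ∧ right i = x)

/-- The outcome of running some `β`-approximation algorithm for the minimum-length Steiner tree
problem on `I`: the tree, its list of edges, and the time that the algorithm took.  Writing down
the tree is part of the computation, so it takes at least one step for each vertex. -/
structure SubroutineRun {M : Type u} [PseudoMetricSpace M] (I : Problem M) (β : ℝ) where
  tree : SteinerTree I
  edges : EdgeList tree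
  isApprox : tree.IsApprox β
  time : ℕ
  card_le_time : I.numSinks + tree.numSteiner + 1 ≤ time

/-! The machine is a real RAM.  It has finitely many arrays in use, each with cells indexed by the
natural numbers, for natural numbers, for real numbers, and for points of the space.  A scalar
variable is a cell with a constant index.  Points can only be copied and have their distance
evaluated. -/

/-- Index expressions: constants, array cells (with indirect addressing), addition, and truncated
subtraction. -/
inductive NatExpr : Type where
  | const (k : ℕ)
  | cell (a : ℕ) (i : NatExpr)
  | add (e f : NatExpr)
  | sub (e f : NatExpr)

/-- Point expressions: array cells. -/
inductive PointExpr : Type where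
  | cell (a : ℕ) (i : NatExpr)

/-- Real expressions: rational constants, array cells, field operations, evaluation of the metric.
Division by zero gives zero. -/
inductive RealExpr : Type where
  | const (q : ℚ)
  | cell (a : ℕ) (i : NatExpr)
  | add (e f : RealExpr)
  | sub (e f : RealExpr)
  | mul (e f : RealExpr)
  | div (e f : RealExpr)
  | metric (x y : PointExpr)

/-- Tests. -/
inductive Test : Type where
  | natLt (e f : NatExpr)
  | natEq (e f : NatExpr)
  | realLt (e f : RealExpr)
  | not (b : Test)
  | and (b c : Test)

/-- Programs.  `steiner` calls the subroutine for minimum-length Steiner trees on the given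
instance.  A program is a finite text that mentions neither the instance nor the space. -/
inductive Program : Type where
  | skip
  | setNat (a : ℕ) (i : NatExpr) (e : NatExpr)
  | setReal (a : ℕ) (i : NatExpr) (e : RealExpr)
  | setPoint (a : ℕ) (i : NatExpr) (e : PointExpr)
  | steiner
  | seq (P Q : Program)
  | ite (b : Test) (P Q : Program)
  | loop (b : Test) (P : Program)

/-- The memory: `nat a i` is cell `i` of the array `a` of natural numbers, and so on. -/
structure Memory (M : Type u) where
  nat : ℕ → ℕ → ℕ
  real : ℕ → ℕ → ℝ
  point : ℕ → ℕ → M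

section Semantics

variable {M : Type u}

/-- The value of an index expression. -/
def NatExpr.eval (σ : Memory M) : NatExpr → ℕ
  | const k => k
  | cell a i => σ.nat a (i.eval σ)
  | add e f => e.eval σ + f.eval σ
  | sub e f => e.eval σ - f.eval σ

/-- The value of a point expression. -/
def PointExpr.eval (σ : Memory M) : PointExpr → M
  | cell a i => σ.point a (i.eval σ)

/-- Cell `i` of the array `a` of natural numbers becomes `x`. -/
def Memory.setNat (σ : Memory M) (a i x : ℕ) : Memory M :=
  { σ with nat := Function.update σ.nat a (Function.update (σ.nat a) i x) }

/-- Cell `i` of the array `a` of real numbers becomes `x`. -/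
noncomputable def Memory.setReal (σ : Memory M) (a i : ℕ) (x : ℝ) : Memory M :=
  { σ with real := Function.update σ.real a (Function.update (σ.real a) i x) }

/-- Cell `i` of the array `a` of points becomes `x`. -/
def Memory.setPoint (σ : Memory M) (a i : ℕ) (x : M) : Memory M :=
  { σ with point := Function.update σ.point a (Function.update (σ.point a) i x) }

/-- The memory holds the Steiner tree `A`, with its list of edges `E`: cell `0` of the array `1` of
natural numbers is the number of Steiner vertices, the arrays `2` and `3` of natural numbers hold
the ends of the edges, and the array `1` of points holds the positions of all vertices. -/
def Memory.Holds {I : Problem M} (σ : Memory M) (A : SteinerTree I) (E : EdgeList A) : Prop :=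
  σ.nat 1 0 = A.numSteiner ∧
  (∀ i : Fin (I.numSinks + A.numSteiner),
    σ.nat 2 i = (E.left i : ℕ) ∧ σ.nat 3 i = (E.right i : ℕ)) ∧
  ∀ x : A.Vertex, σ.point 1 x = A.pos x

/-- The memory after the Steiner tree `A` with list of edges `E` has been written to the arrays
where `Memory.Holds` expects it.  All other cells keep their contents. -/
def Memory.store {I : Problem M} (σ : Memory M) (A : SteinerTree I) (E : EdgeList A) :
    Memory M where
  nat a i :=
    if a = 1 ∧ i = 0 then A.numSteiner
    else if h : i < I.numSinks + A.numSteiner then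
      if a = 2 then (E.left ⟨i, h⟩ : ℕ)
      else if a = 3 then (E.right ⟨i, h⟩ : ℕ)
      else σ.nat a i
    else σ.nat a i
  real := σ.real
  point a i :=
    if h : a = 1 ∧ i < I.numSinks + A.numSteiner + 1 then A.pos ⟨i, h.2⟩ else σ.point a i

/-- The initial memory on the instance `I` and the threshold `μ`: the number of sinks is in cell `0`
of the array `0` of natural numbers, the weights are in the array `0` of real numbers, `μ` is in
cell `0` of the array `1` of real numbers, and the positions of the root and of the sinks are in the
cells `0` and `1, …, numSinks` of the array `0` of points.  All other cells are blank, which means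
`0` for numbers and the position of the root for points. -/
noncomputable def Memory.initial (I : Problem M) (μ : ℝ) : Memory M where
  nat a i := if a = 0 ∧ i = 0 then I.numSinks else 0
  real a i :=
    if a = 1 ∧ i = 0 then μ
    else if h : a = 0 ∧ i < I.numSinks then (I.weight ⟨i, h.2⟩ : ℝ)
    else 0
  point a i :=
    if h : a = 0 ∧ 1 ≤ i ∧ i ≤ I.numSinks then I.sinkPos ⟨i - 1, by omega⟩ else I.rootPos

variable [PseudoMetricSpace M]

/-- The value of a real expression. -/
noncomputable def RealExpr.eval (σ : Memory M) : RealExpr → ℝ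
  | const q => (q : ℝ)
  | cell a i => σ.real a (i.eval σ)
  | add e f => e.eval σ + f.eval σ
  | sub e f => e.eval σ - f.eval σ
  | mul e f => e.eval σ * f.eval σ
  | div e f => e.eval σ / f.eval σ
  | metric x y => dist (x.eval σ) (y.eval σ)

/-- The truth of a test. -/
def Test.Holds (σ : Memory M) : Test → Prop
  | natLt e f => e.eval σ < f.eval σ
  | natEq e f => e.eval σ = f.eval σ
  | realLt e f => e.eval σ < f.eval σ
  | not b => ¬ b.Holds σ
  | and b c => b.Holds σ ∧ c.Holds σ

/-- `Exec R P σ k τ`: started in the memory `σ`, the program `P` halts after exactly `k` steps in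
the memory `τ`, where `R` is the run of the subroutine on the instance.  Every elementary statement
and every evaluation of the test of a branching or of a loop is one step (the expressions in a fixed
program have bounded size), and a call of the subroutine takes the time of the subroutine. -/
inductive Exec {I : Problem M} {β : ℝ} (R : SubroutineRun I β) :
    Program → Memory M → ℕ → Memory M → Prop
  | skip (σ : Memory M) : Exec R Program.skip σ 1 σ
  | setNat (σ : Memory M) (a : ℕ) (i e : NatExpr) :
      Exec R (Program.setNat a i e) σ 1 (σ.setNat a (i.eval σ) (e.eval σ))
  | setReal (σ : Memory M) (a : ℕ) (i : NatExpr) (e : RealExpr) :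
      Exec R (Program.setReal a i e) σ 1 (σ.setReal a (i.eval σ) (e.eval σ))
  | setPoint (σ : Memory M) (a : ℕ) (i : NatExpr) (e : PointExpr) :
      Exec R (Program.setPoint a i e) σ 1 (σ.setPoint a (i.eval σ) (e.eval σ))
  | steiner (σ : Memory M) :
      Exec R Program.steiner σ R.time (σ.store R.tree R.edges)
  | seq {P Q : Program} {σ τ ρ : Memory M} {k l : ℕ} :
      Exec R P σ k τ → Exec R Q τ l ρ → Exec R (Program.seq P Q) σ (k + l) ρ
  | ite_true {b : Test} {P Q : Program} {σ τ : Memory M} {k : ℕ} :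
      b.Holds σ → Exec R P σ k τ → Exec R (Program.ite b P Q) σ (k + 1) τ
  | ite_false {b : Test} {P Q : Program} {σ τ : Memory M} {k : ℕ} :
      ¬ b.Holds σ → Exec R Q σ k τ → Exec R (Program.ite b P Q) σ (k + 1) τ
  | loop_true {b : Test} {P : Program} {σ τ ρ : Memory M} {k l : ℕ} :
      b.Holds σ → Exec R P σ k τ → Exec R (Program.loop b P) τ l ρ →
      Exec R (Program.loop b P) σ (k + l + 1) ρ
  | loop_false {b : Test} {P : Program} {σ : Memory M} :
      ¬ b.Holds σ → Exec R (Program.loop b P) σ 1 σ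

end Semantics

end CostDistance

/-!
Root the given tree at `r` and write `c v` for the length of the edge above `v`, `d v` for the
distance of `v` from the root in the space and `D` for `∑ w v * d v`.  The new tree arises by
cutting off subtrees (*clusters*) and connecting each of them to the root by one new edge, which ends
at a vertex of the cluster, its *centre*.  The remaining edges are *kept*; `load v`, here `X v`, is
the weight of the part of the cluster of `v` that lies weakly below `v`.

Consider a cluster with top `v` and total weight `X = X v`.  If the centre is chosen at random, with
probability proportional to the weight, then the new edge and the delay of the cluster cost
`D' / X + D' + ∑ 2 * X f * (1 - X f / X) * c f` on average, where `f` runs over the kept edges of the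
cluster and `D'` is the part of `D` in the cluster.  The best centre is at least as good.  Compared
with the permitted amount `(1 + 1 / μ) * D' + (μ / 2) * ∑ c f`, which is allowed to include the edge
above `v`, the excess times `X` is at most `α + X * γ`, where, with sums over the cluster,
`α = ∑ (w s * d s - 2 * X s ^ 2 * c s)` and `γ = ∑ ((2 * X s - μ / 2) * c s - w s * d s / μ)`
(`γ` is `edgeScore v`).  Always `α + μ * γ = -2 * ∑ (X s - μ / 2) ^ 2 * c s ≤ 0`.

The rule is to cut above `v`, going from the leaves to the root, if and only if `γ > 0`.
If a cut is made and `X ≤ μ`, then `α + X * γ ≤ α + μ * γ ≤ 0`.  If `X > μ`, then `γ` is at most the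
contribution of the edge above `v`, because all kept edges just below have nonpositive score, and
again `α + X * γ ≤ 0` (`Clustering.excess_nonpos`).  In the cluster that contains the root the delay
is `∑ X f * c f`, and the nonpositive scores of the kept edges say that this is at most
`D' / μ + (μ / 2) * ∑ c f` (`Clustering.root_cluster_cost_le`).  Summing over all clusters gives
`Clustering.cost_le`, the theorem with `1 / 2` in place of the larger constant `b`.

The new tree has the same vertices as the old one, and only some entries of the list of edges
change (`exists_reconnected`).  The program needs linear time: counting the incident edges of every
vertex and adding up their numbers allows it to peel the leaves off one after the other, because at a
leaf the sum is the number of the only edge left.  In the resulting order loads and scores are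
computed from the leaves to the root, and then, from the root to the leaves, the sum of the
weighted distances within a cluster as a function of the centre: this sum changes by
`(X - 2 * X u) * c u` when the centre moves from the parent of `u` to `u`.
-/

namespace CostDistance

/-! ### Rooted trees and their clusters -/

/-- A tree on the vertices `0, …, N`, rooted at `0` and given by its parent map.  The depth witnesses
that following parents leads to the root. -/
structure RootedTree (N : ℕ) where
  parent : Fin (N + 1) → Fin (N + 1)
  depth : Fin (N + 1) → ℕ
  parent_zero : parent 0 = 0
  depth_eq : ∀ v, v ≠ 0 → depth v = depth (parent v) + 1

namespace RootedTree

variable {N : ℕ} (T : RootedTree N)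

/-- Recursion from the root to the leaves. -/
theorem exists_topDown {α : Type*} (a : α) (F : Fin (N + 1) → α → α) :
    ∃ f : Fin (N + 1) → α, f 0 = a ∧ ∀ v, v ≠ 0 → f v = F v (f (T.parent v)) := by
  let g : ℕ → Fin (N + 1) → α := fun k => Nat.rec (fun _ => a)
    (fun _ h v => if v = 0 then a else F v (h (T.parent v))) k
  refine ⟨fun v => g (T.depth v) v, ?_, fun v hv => ?_⟩
  · change g (T.depth 0) 0 = a
    cases T.depth 0 <;> simp [g]
  · change g (T.depth v) v = F v (g (T.depth (T.parent v)) (T.parent v))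
    rw [T.depth_eq v hv]
    simp [g, hv]

/-- Recursion from the leaves to the root. -/
theorem exists_bottomUp {α : Type*} [AddCommMonoid α] (a : Fin (N + 1) → α)
    (φ : Fin (N + 1) → α → α) :
    ∃ f : Fin (N + 1) → α,
      ∀ v, f v = a v + ∑ u, if u ≠ 0 ∧ T.parent u = v then φ u (f u) else 0 := by
  let g : ℕ → Fin (N + 1) → α := fun k => Nat.rec a
    (fun _ h v => a v + ∑ u, if u ≠ 0 ∧ T.parent u = v then φ u (h u) else 0) k
  obtain ⟨B, hB⟩ : ∃ B, ∀ v, T.depth v < B :=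
    ⟨(Finset.univ.sup T.depth) + 1, fun v => Nat.lt_succ_of_le (Finset.le_sup (Finset.mem_univ v))⟩
  -- After `B - depth v` rounds the value at `v` no longer changes.
  have key : ∀ k v, B ≤ k + T.depth v → g (k + 1) v = g k v := by
    intro k
    induction k with
    | zero => intro v hv; have := hB v; omega
    | succ k ih =>
      intro v hv
      change a v + _ = a v + _
      congr 1
      refine Finset.sum_congr rfl fun u _ => ?_
      split_ifs with h
      · congr 1
        refine ih u ?_
        have := T.depth_eq u h.1
        rw [h.2] at this
        omega
      · rfl
  exact ⟨g B, fun v => (key B v (by omega)).symm⟩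

end RootedTree

/-- The data that the algorithm computes on a rooted tree: `c v` is the length of the edge from `v`
to its parent, `d v` the distance from the root, `w v` the delay weight, `μ` the threshold.  The edge
above `v` is kept if `score v + (2 * load v - μ / 2) * c v ≤ 0`; the kept edges form clusters.
`load v` is the weight of the part of the cluster below `v`, `top v` is the highest vertex of the
cluster of `v`, and `reroot v` is the change of the weighted sum of distances within the cluster
when the centre moves from `top v` to `v`. -/
structure Clustering {N : ℕ} (T : RootedTree N) (c d w : Fin (N + 1) → ℝ) (μ : ℝ) where
  load : Fin (N + 1) → ℝ
  score : Fin (N + 1) → ℝ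
  top : Fin (N + 1) → Fin (N + 1)
  reroot : Fin (N + 1) → ℝ
  load_eq : ∀ v, load v = w v + ∑ u, if u ≠ 0 ∧ T.parent u = v then
    if 0 < score u + (2 * load u - μ / 2) * c u then 0 else load u else 0
  score_eq : ∀ v, score v = -(w v * d v / μ) + ∑ u, if u ≠ 0 ∧ T.parent u = v then
    if 0 < score u + (2 * load u - μ / 2) * c u then 0
    else score u + (2 * load u - μ / 2) * c u else 0
  top_zero : top 0 = 0
  top_eq : ∀ v, v ≠ 0 → top v =
    if 0 < score v + (2 * load v - μ / 2) * c v then v else top (T.parent v)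
  reroot_zero : reroot 0 = 0
  reroot_eq : ∀ v, v ≠ 0 → reroot v =
    if 0 < score v + (2 * load v - μ / 2) * c v then 0
    else reroot (T.parent v) + (load (top v) - 2 * load v) * c v

namespace Clustering

variable {N : ℕ} {T : RootedTree N} {c d w : Fin (N + 1) → ℝ} {μ : ℝ}

theorem nonempty (T : RootedTree N) (c d w : Fin (N + 1) → ℝ) (μ : ℝ) :
    Nonempty (Clustering T c d w μ) := by
  obtain ⟨f, hf⟩ := T.exists_bottomUp (α := ℝ × ℝ) (fun v => (w v, -(w v * d v / μ)))
    (fun u x => if 0 < x.2 + (2 * x.1 - μ / 2) * c u then 0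
      else (x.1, x.2 + (2 * x.1 - μ / 2) * c u))
  obtain ⟨t, ht0, ht⟩ := T.exists_topDown (0 : Fin (N + 1))
    (fun v x => if 0 < (f v).2 + (2 * (f v).1 - μ / 2) * c v then v else x)
  obtain ⟨s, hs0, hs⟩ := T.exists_topDown (0 : ℝ)
    (fun v x => if 0 < (f v).2 + (2 * (f v).1 - μ / 2) * c v then 0
      else x + ((f (t v)).1 - 2 * (f v).1) * c v)
  refine ⟨⟨fun v => (f v).1, fun v => (f v).2, t, s, fun v => ?_, fun v => ?_, ht0, ht, hs0, hs⟩⟩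
  · have := congrArg Prod.fst (hf v)
    rw [Prod.fst_add, Prod.fst_sum] at this
    rw [this]
    congr 1
    refine Finset.sum_congr rfl fun u _ => ?_
    split_ifs <;> rfl
  · have := congrArg Prod.snd (hf v)
    rw [Prod.snd_add, Prod.snd_sum] at this
    rw [this]
    congr 1
    refine Finset.sum_congr rfl fun u _ => ?_
    split_ifs <;> rfl

variable (Z : Clustering T c d w μ)

/-- The score of a vertex including the edge to its parent. -/
noncomputable def edgeScore (v : Fin (N + 1)) : ℝ := Z.score v + (2 * Z.load v - μ / 2) * c v

/-- The edge from `v` to its parent belongs to a cluster. -/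
def Kept (v : Fin (N + 1)) : Prop := v ≠ 0 ∧ ¬ 0 < Z.edgeScore v

/-- `s` lies weakly below `f` in the cluster of `f`. -/
def Below : Fin (N + 1) → Fin (N + 1) → Prop :=
  Relation.ReflTransGen fun a b => Z.Kept a ∧ T.parent a = b

open Classical in
/-- The indicator function of `Below`. -/
noncomputable def ind (s f : Fin (N + 1)) : ℝ := if Z.Below s f then 1 else 0

theorem Below.eq_or_depth_lt {Z : Clustering T c d w μ} {s f : Fin (N + 1)} (h : Z.Below s f) :
    s = f ∨ T.depth f < T.depth s := by
  induction h with
  | refl => exact Or.inl rfl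
  | tail _ hbc ih =>
    have := T.depth_eq _ hbc.1.1
    rw [hbc.2] at this
    rcases ih with rfl | ih <;> right <;> omega

theorem below_iff (s f : Fin (N + 1)) :
    Z.Below s f ↔ s = f ∨ Z.Kept s ∧ Z.Below (T.parent s) f := by
  constructor
  · intro h
    rcases Relation.ReflTransGen.cases_head h with h | ⟨b, ⟨hk, rfl⟩, hb⟩
    · exact Or.inl h
    · exact Or.inr ⟨hk, hb⟩
  · rintro (rfl | ⟨hk, hb⟩)
    · exact Relation.ReflTransGen.refl
    · exact Relation.ReflTransGen.head ⟨hk, rfl⟩ hb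

open Classical in
theorem ind_eq (s f : Fin (N + 1)) :
    Z.ind s f = (if s = f then 1 else 0) + if Z.Kept s then Z.ind (T.parent s) f else 0 := by
  unfold ind
  by_cases hsf : s = f
  · subst hsf
    have h1 : Z.Below s s := Relation.ReflTransGen.refl
    have h2 : Z.Kept s → ¬ Z.Below (T.parent s) s := by
      intro hk hb
      have := T.depth_eq s hk.1
      rcases hb.eq_or_depth_lt with h | h
      · rw [h] at this; omega
      · omega
    by_cases hk : Z.Kept s <;> simp [h1, hk, h2]
  · have := Z.below_iff s f
    by_cases hk : Z.Kept s <;> simp [this, hsf, hk]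

theorem ind_self (v : Fin (N + 1)) : Z.ind v v = 1 := by
  have h1 : Z.Below v v := Relation.ReflTransGen.refl
  simp [ind, h1]

theorem ind_nonneg (s f : Fin (N + 1)) : 0 ≤ Z.ind s f := by
  unfold ind; split_ifs <;> norm_num

open Classical in
/-- A function defined by recursion over the kept edges is a sum over everything below. -/
theorem sum_ind_mul {g h : Fin (N + 1) → ℝ}
    (hh : ∀ v, h v = g v + ∑ u, if Z.Kept u ∧ T.parent u = v then h u else 0) (v : Fin (N + 1)) :
    h v = ∑ s, Z.ind s v * g s := by
  have h1 : ∀ s, g s = h s - ∑ u, if Z.Kept u ∧ T.parent u = s then h u else 0 := fun s => by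
    rw [hh s]; ring
  have h2 : ∑ s, Z.ind s v * ∑ u, (if Z.Kept u ∧ T.parent u = s then h u else 0)
      = ∑ u, (if Z.Kept u then Z.ind (T.parent u) v else 0) * h u := by
    simp_rw [Finset.mul_sum]
    rw [Finset.sum_comm]
    refine Finset.sum_congr rfl fun u _ => ?_
    by_cases hk : Z.Kept u <;> simp [hk]
  have h3 : ∀ s, Z.ind s v * h s - (if Z.Kept s then Z.ind (T.parent s) v else 0) * h s =
      if s = v then h s else 0 := by
    intro s
    rw [Z.ind_eq s v]
    split_ifs <;> ring
  simp_rw [h1, mul_sub, Finset.sum_sub_distrib, h2, ← Finset.sum_sub_distrib, h3]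
  simp

open Classical in
theorem load_eq_sum (v : Fin (N + 1)) : Z.load v = ∑ s, Z.ind s v * w s := by
  refine Z.sum_ind_mul (fun v => ?_) v
  rw [Z.load_eq v]
  congr 1
  refine Finset.sum_congr rfl fun u _ => ?_
  unfold Kept edgeScore
  split_ifs <;> first | rfl | (exfalso; tauto)

open Classical in
theorem edgeScore_eq_sum (v : Fin (N + 1)) :
    Z.edgeScore v = ∑ s, Z.ind s v * ((2 * Z.load s - μ / 2) * c s - w s * d s / μ) := by
  refine Z.sum_ind_mul (fun v => ?_) v
  rw [edgeScore, Z.score_eq v]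
  have : (∑ u, if u ≠ 0 ∧ T.parent u = v then
      if 0 < Z.score u + (2 * Z.load u - μ / 2) * c u then 0
      else Z.score u + (2 * Z.load u - μ / 2) * c u else 0) =
      ∑ u, if Z.Kept u ∧ T.parent u = v then Z.edgeScore u else 0 := by
    refine Finset.sum_congr rfl fun u _ => ?_
    unfold Kept edgeScore
    split_ifs <;> first | rfl | (exfalso; tauto)
  rw [this]; ring

theorem score_nonpos (hw : ∀ v, 0 ≤ w v) (hd : ∀ v, 0 ≤ d v) (hμ : 0 < μ) (v : Fin (N + 1)) :
    Z.score v ≤ 0 := by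
  rw [Z.score_eq v]
  have h1 : 0 ≤ w v * d v / μ := div_nonneg (mul_nonneg (hw v) (hd v)) hμ.le
  have h2 : (∑ u, if u ≠ 0 ∧ T.parent u = v then
      if 0 < Z.score u + (2 * Z.load u - μ / 2) * c u then 0
      else Z.score u + (2 * Z.load u - μ / 2) * c u else 0) ≤ 0 := by
    refine Finset.sum_nonpos fun u _ => ?_
    split_ifs with h h' <;> linarith
  linarith

theorem load_nonneg (hw : ∀ v, 0 ≤ w v) (v : Fin (N + 1)) : 0 ≤ Z.load v := by
  rw [Z.load_eq_sum]
  exact Finset.sum_nonneg fun s _ => mul_nonneg (Z.ind_nonneg s v) (hw s)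

theorem load_le (hw : ∀ v, 0 ≤ w v) {s v : Fin (N + 1)} (h : Z.Below s v) :
    Z.load s ≤ Z.load v := by
  rw [Z.load_eq_sum, Z.load_eq_sum]
  refine Finset.sum_le_sum fun t _ => mul_le_mul_of_nonneg_right ?_ (hw t)
  unfold ind
  split_ifs with h1 h2
  · exact le_rfl
  · exact absurd (h1.trans h) h2
  · norm_num
  · exact le_rfl

/-- A cluster without weight is never cut off. -/
theorem load_pos (hw : ∀ v, 0 ≤ w v) (hd : ∀ v, 0 ≤ d v) (hc : ∀ v, 0 ≤ c v) (hμ : 0 < μ)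
    {v : Fin (N + 1)} (h : 0 < Z.edgeScore v) : 0 < Z.load v := by
  by_contra hX
  refine absurd h (not_lt.2 ?_)
  rw [Z.edgeScore_eq_sum]
  refine Finset.sum_nonpos fun s _ => ?_
  by_cases hs : Z.Below s v
  · have h1 := Z.load_le hw hs
    have h2 : 0 ≤ w s * d s / μ := div_nonneg (mul_nonneg (hw s) (hd s)) hμ.le
    refine mul_nonpos_of_nonneg_of_nonpos (Z.ind_nonneg s v) ?_
    nlinarith [hc s]
  · simp [ind, hs]

/-- The combination of the costs of a cluster that is linear in the total weight of the cluster is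
nonpositive: for total weight `μ` it is minus a sum of squares. -/
theorem excess_nonpos (hw : ∀ v, 0 ≤ w v) (hd : ∀ v, 0 ≤ d v) (hc : ∀ v, 0 ≤ c v) (hμ : 0 < μ)
    {v : Fin (N + 1)} (h : 0 < Z.edgeScore v) :
    ∑ s, Z.ind s v * (w s * d s - 2 * Z.load s ^ 2 * c s) + Z.load v * Z.edgeScore v ≤ 0 := by
  have h1 : ∑ s, Z.ind s v * (w s * d s - 2 * Z.load s ^ 2 * c s) + μ * Z.edgeScore v
      = - ∑ s, Z.ind s v * (2 * (Z.load s - μ / 2) ^ 2 * c s) := by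
    rw [Z.edgeScore_eq_sum, Finset.mul_sum, ← Finset.sum_add_distrib, ← Finset.sum_neg_distrib]
    refine Finset.sum_congr rfl fun s _ => ?_
    field_simp
    ring
  have h0 : ∀ s, 0 ≤ Z.ind s v * (2 * (Z.load s - μ / 2) ^ 2 * c s) := fun s =>
    mul_nonneg (Z.ind_nonneg s v) (mul_nonneg (by positivity) (hc s))
  have h2 : 2 * (Z.load v - μ / 2) ^ 2 * c v ≤
      ∑ s, Z.ind s v * (2 * (Z.load s - μ / 2) ^ 2 * c s) := by
    have := Finset.single_le_sum (fun s _ => h0 s) (Finset.mem_univ v)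
    simpa [Z.ind_self] using this
  rcases le_total (Z.load v) μ with hX | hX
  · have := Finset.sum_nonneg fun s (_ : s ∈ Finset.univ) => h0 s
    nlinarith
  · -- All kept edges below `v` have nonpositive score, so only the edge above `v` contributes.
    have h3 : Z.edgeScore v ≤ (2 * Z.load v - μ / 2) * c v := by
      have := Z.score_nonpos hw hd hμ v
      unfold edgeScore; linarith
    have h4 := mul_le_mul_of_nonneg_left h3 (sub_nonneg.2 hX)
    have h5 : 0 ≤ Z.load v * μ * c v :=
      mul_nonneg (mul_nonneg (hμ.le.trans hX) hμ.le) (hc v)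
    nlinarith

theorem not_kept_top (v : Fin (N + 1)) : ¬ Z.Kept (Z.top v) := by
  induction hn : T.depth v generalizing v with
  | zero =>
    by_cases hv : v = 0
    · subst hv; rw [Z.top_zero]; exact fun h => h.1 rfl
    · have := T.depth_eq v hv; omega
  | succ n ih =>
    by_cases hv : v = 0
    · subst hv; rw [Z.top_zero]; exact fun h => h.1 rfl
    · rw [Z.top_eq v hv]
      split_ifs with h
      · exact fun hk => hk.2 h
      · refine ih _ ?_
        have := T.depth_eq v hv; omega

theorem top_of_kept {v : Fin (N + 1)} (h : Z.Kept v) : Z.top v = Z.top (T.parent v) := by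
  rw [Z.top_eq v h.1, if_neg]; exact h.2

theorem top_of_not_kept {v : Fin (N + 1)} (h : ¬ Z.Kept v) : Z.top v = v := by
  by_cases hv : v = 0
  · subst hv; exact Z.top_zero
  · rw [Z.top_eq v hv, if_pos]
    by_contra h'
    exact h ⟨hv, h'⟩

theorem Below.top_eq {Z : Clustering T c d w μ} {s f : Fin (N + 1)} (h : Z.Below s f) :
    Z.top s = Z.top f := by
  induction h with
  | refl => rfl
  | tail _ hbc ih => rw [ih, Z.top_of_kept hbc.1, hbc.2]

theorem below_top (s : Fin (N + 1)) : Z.Below s (Z.top s) := by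
  induction hn : T.depth s using Nat.strong_induction_on generalizing s with
  | _ n ih =>
    by_cases hk : Z.Kept s
    · rw [Z.below_iff]
      right
      refine ⟨hk, ?_⟩
      rw [Z.top_of_kept hk]
      refine ih _ ?_ _ rfl
      have := T.depth_eq s hk.1; omega
    · rw [Z.top_of_not_kept hk]; exact Relation.ReflTransGen.refl

theorem below_iff_top_eq {v : Fin (N + 1)} (hv : ¬ Z.Kept v) (s : Fin (N + 1)) :
    Z.Below s v ↔ Z.top s = v := by
  constructor
  · intro h; rw [h.top_eq, Z.top_of_not_kept hv]
  · rintro rfl; exact Z.below_top s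

open Classical in
theorem ind_eq_ite {v : Fin (N + 1)} (hv : ¬ Z.Kept v) (s : Fin (N + 1)) :
    Z.ind s v = if Z.top s = v then 1 else 0 := by
  simp [ind, Z.below_iff_top_eq hv]

theorem ind_mul_ind {v : Fin (N + 1)} (hv : ¬ Z.Kept v) (s f : Fin (N + 1)) :
    Z.ind s v * Z.ind s f = Z.ind f v * Z.ind s f := by
  by_cases h : Z.Below s f
  · rw [Z.ind_eq_ite hv, Z.ind_eq_ite hv, h.top_eq]
  · simp [ind, h]

open Classical in
theorem reroot_eq_sum (s : Fin (N + 1)) :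
    Z.reroot s = ∑ f, if Z.Kept f then
      Z.ind s f * ((Z.load (Z.top s) - 2 * Z.load f) * c f) else 0 := by
  induction hn : T.depth s using Nat.strong_induction_on generalizing s with
  | _ n ih =>
    by_cases hk : Z.Kept s
    · rw [Z.reroot_eq s hk.1, if_neg (by exact hk.2), ih _ _ (T.parent s) rfl,
        ← Z.top_of_kept hk]
      · have h1 : ∀ f, (if Z.Kept f then
            Z.ind s f * ((Z.load (Z.top s) - 2 * Z.load f) * c f) else 0) =
            (if Z.Kept f then
            Z.ind (T.parent s) f * ((Z.load (Z.top s) - 2 * Z.load f) * c f) else 0) +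
            if s = f then (Z.load (Z.top s) - 2 * Z.load s) * c s else 0 := by
          intro f
          rw [Z.ind_eq s f, if_pos hk]
          by_cases hsf : s = f
          · subst hsf; simp [hk]; ring
          · simp [hsf]
        simp_rw [h1, Finset.sum_add_distrib]
        simp
      · have := T.depth_eq s hk.1; omega
    · have h1 : Z.reroot s = 0 := by
        by_cases hs : s = 0
        · subst hs; exact Z.reroot_zero
        · rw [Z.reroot_eq s hs, if_pos]
          by_contra h'
          exact hk ⟨hs, h'⟩
      rw [h1]
      symm
      refine Finset.sum_eq_zero fun f _ => ?_
      split_ifs with hf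
      · have : s ≠ f := fun h => hk (h ▸ hf)
        rw [Z.ind_eq s f]
        simp [hk, this]
      · rfl

open Classical in
/-- The length of the path between two vertices of a cluster: an edge is on the path if exactly one
of the two vertices is below it. -/
noncomputable def clusterDist (t s : Fin (N + 1)) : ℝ :=
  ∑ f, if Z.Kept f then c f * (Z.ind t f + Z.ind s f - 2 * (Z.ind t f * Z.ind s f)) else 0

theorem clusterDist_comm (t s : Fin (N + 1)) : Z.clusterDist t s = Z.clusterDist s t := by
  unfold clusterDist
  refine Finset.sum_congr rfl fun f _ => ?_
  split_ifs
  · ring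
  · rfl

theorem clusterDist_self (t : Fin (N + 1)) : Z.clusterDist t t = 0 := by
  refine Finset.sum_eq_zero fun f _ => ?_
  split_ifs
  · unfold ind; split_ifs <;> ring
  · rfl

theorem clusterDist_parent {t s : Fin (N + 1)} (ht : Z.Kept t) (hs : ¬ Z.Below s t) :
    Z.clusterDist t s = c t + Z.clusterDist (T.parent t) s := by
  classical
  have h1 : ∀ f, (if Z.Kept f then
      c f * (Z.ind t f + Z.ind s f - 2 * (Z.ind t f * Z.ind s f)) else 0) =
      (if t = f then c t else 0) + if Z.Kept f then
      c f * (Z.ind (T.parent t) f + Z.ind s f - 2 * (Z.ind (T.parent t) f * Z.ind s f)) else 0 := by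
    intro f
    rw [Z.ind_eq t f, if_pos ht]
    by_cases hf : t = f
    · subst hf
      have : Z.ind s t = 0 := by simp [ind, hs]
      simp [ht, this]; ring
    · simp [hf]
  unfold clusterDist
  simp_rw [h1, Finset.sum_add_distrib]
  simp

/-- A quantity that satisfies the triangle inequality along kept edges is at most the length of the
path within the cluster. -/
theorem le_clusterDist {P : Fin (N + 1) → Fin (N + 1) → ℝ} (hself : ∀ v, P v v = 0)
    (hl : ∀ t s, Z.Kept t → P t s ≤ c t + P (T.parent t) s)
    (hr : ∀ t s, Z.Kept s → P t s ≤ c s + P t (T.parent s))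
    {t s : Fin (N + 1)} (h : Z.top t = Z.top s) : P t s ≤ Z.clusterDist t s := by
  induction hn : T.depth t + T.depth s using Nat.strong_induction_on generalizing t s with
  | _ n ih =>
    -- The deeper of two distinct vertices of a cluster is not its top and has the other not below.
    have key : ∀ a b, Z.top a = Z.top b → a ≠ b → T.depth b ≤ T.depth a →
        Z.Kept a ∧ ¬ Z.Below b a := by
      intro a b hab hne hdep
      have hb : ¬ Z.Below b a := fun hb => by
        rcases hb.eq_or_depth_lt with h' | h'
        · exact hne h'.symm
        · omega
      refine ⟨?_, hb⟩
      by_contra hk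
      exact hb ((Z.below_iff_top_eq hk b).2 (by rw [← hab, Z.top_of_not_kept hk]))
    by_cases hts : t = s
    · subst hts; rw [hself, Z.clusterDist_self]
    · rcases le_total (T.depth s) (T.depth t) with hd | hd
      · obtain ⟨hk, hb⟩ := key t s h hts hd
        rw [Z.clusterDist_parent hk hb]
        have h1 := T.depth_eq t hk.1
        have := ih _ (by omega) (t := T.parent t) (s := s) (by rw [← Z.top_of_kept hk, h]) rfl
        linarith [hl t s hk]
      · obtain ⟨hk, hb⟩ := key s t h.symm (Ne.symm hts) hd
        rw [Z.clusterDist_comm, Z.clusterDist_parent hk hb, Z.clusterDist_comm]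
        have h1 := T.depth_eq s hk.1
        have := ih _ (by omega) (t := t) (s := T.parent s) (by rw [← Z.top_of_kept hk, h]) rfl
        linarith [hr t s hk]

open Classical in
/-- The weighted sum of the distances from `t` within its cluster. -/
theorem sum_clusterDist {v : Fin (N + 1)} (hv : ¬ Z.Kept v) {t : Fin (N + 1)} (ht : Z.top t = v) :
    ∑ s, Z.ind s v * (w s * Z.clusterDist t s) =
      Z.reroot t + ∑ f, if Z.Kept f then Z.ind f v * (Z.load f * c f) else 0 := by
  rw [Z.reroot_eq_sum, ht, ← Finset.sum_add_distrib]
  unfold clusterDist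
  simp_rw [Finset.mul_sum]
  rw [Finset.sum_comm]
  refine Finset.sum_congr rfl fun f _ => ?_
  by_cases hf : Z.Kept f
  · simp only [hf, if_true]
    have htv : Z.ind t v = 1 := by rw [Z.ind_eq_ite hv, if_pos ht]
    have hft : Z.ind t f = Z.ind f v * Z.ind t f := by
      rw [← Z.ind_mul_ind hv, htv, one_mul]
    have h1 : ∀ s, Z.ind s v * (w s * (c f * (Z.ind t f + Z.ind s f - 2 * (Z.ind t f * Z.ind s f))))
        = c f * Z.ind t f * (Z.ind s v * w s) +
          c f * (1 - 2 * Z.ind t f) * (Z.ind f v * (Z.ind s f * w s)) := by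
      intro s
      have := Z.ind_mul_ind hv s f
      linear_combination (w s * c f * (1 - 2 * Z.ind t f)) * this
    simp_rw [h1, Finset.sum_add_distrib, ← Finset.mul_sum, ← Z.load_eq_sum]
    linear_combination (2 * c f * Z.load f) * hft
  · simp [hf]

open Classical in
theorem sum_ind_kept {v : Fin (N + 1)} (hv : ¬ Z.Kept v) (g : Fin (N + 1) → ℝ) :
    (∑ f, if Z.Kept f then Z.ind f v * g f else 0) = ∑ f, Z.ind f v * g f - g v := by
  have h1 : ∀ f, (if Z.Kept f then Z.ind f v * g f else 0) =
      Z.ind f v * g f - if f = v then g v else 0 := by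
    intro f
    by_cases hf : f = v
    · subst hf; simp [hv, Z.ind_self]
    · by_cases hk : Z.Kept f
      · simp [hk, hf]
      · rw [Z.ind_eq]; simp [hk, hf]
  simp_rw [h1, Finset.sum_sub_distrib]
  simp

/-- The cost of reconnecting the cut-off cluster with top `v` to the root through the best of its
vertices.  The best vertex is at least as good as a random one, chosen with probability proportional
to the delay weight. -/
theorem cluster_cost_le (hw : ∀ v, 0 ≤ w v) (hd : ∀ v, 0 ≤ d v) (hc : ∀ v, 0 ≤ c v) (hμ : 0 < μ)
    {v : Fin (N + 1)} (hv : v ≠ 0) (hk : ¬ Z.Kept v) {b : Fin (N + 1)} (hb : Z.top b = v)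
    (hmin : ∀ s, Z.top s = v →
      (1 + Z.load v) * d b + Z.reroot b ≤ (1 + Z.load v) * d s + Z.reroot s) :
    d b + ∑ s, Z.ind s v * (w s * (d b + Z.clusterDist b s)) ≤
      ∑ s, Z.ind s v * ((1 + 1 / μ) * (w s * d s) + μ / 2 * c s) := by
  classical
  have hpos : 0 < Z.edgeScore v := by
    by_contra h; exact hk ⟨hv, h⟩
  have hX := Z.load_pos hw hd hc hμ hpos
  have hexc := Z.excess_nonpos hw hd hc hμ hpos
  set X := Z.load v with hXdef
  have hsumw : ∑ s, Z.ind s v * w s = X := (Z.load_eq_sum v).symm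
  have hB := Z.sum_ind_kept hk (fun f => Z.load f * c f)
  -- The average of the costs over all choices of the vertex.
  have havg : ∑ t, Z.ind t v * (w t * ((1 + X) * d t + Z.reroot t)) =
      ∑ s, Z.ind s v * ((1 + X) * (w s * d s)) +
        ∑ f, Z.ind f v * ((X - 2 * Z.load f) * Z.load f * c f) + X * X * c v := by
    have h1 : ∑ t, Z.ind t v * (w t * Z.reroot t) =
        ∑ f, if Z.Kept f then Z.ind f v * ((X - 2 * Z.load f) * Z.load f * c f) else 0 := by
      have h2 : ∀ t, Z.ind t v * (w t * Z.reroot t) = ∑ f, if Z.Kept f then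
          (X - 2 * Z.load f) * c f * Z.ind f v * (Z.ind t f * w t) else 0 := by
        intro t
        rw [Z.reroot_eq_sum, Finset.mul_sum, Finset.mul_sum]
        refine Finset.sum_congr rfl fun f _ => ?_
        by_cases hf : Z.Kept f
        · simp only [hf, if_true]
          by_cases htv : Z.top t = v
          · have := Z.ind_mul_ind hk t f
            rw [htv, ← hXdef]
            linear_combination ((X - 2 * Z.load f) * c f * w t) * this
          · have h0 : Z.ind t v = 0 := by rw [Z.ind_eq_ite hk, if_neg htv]
            have := Z.ind_mul_ind hk t f
            rw [h0] at this ⊢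
            linear_combination ((X - 2 * Z.load f) * c f * w t) * this
        · simp [hf]
      simp_rw [h2]
      rw [Finset.sum_comm]
      refine Finset.sum_congr rfl fun f _ => ?_
      by_cases hf : Z.Kept f
      · simp only [hf, if_true]
        rw [← Finset.mul_sum, ← Z.load_eq_sum]; ring
      · simp [hf]
    rw [Z.sum_ind_kept hk] at h1
    have h3 : ∀ t, Z.ind t v * (w t * ((1 + X) * d t + Z.reroot t)) =
        Z.ind t v * ((1 + X) * (w t * d t)) + Z.ind t v * (w t * Z.reroot t) := fun t => by ring
    simp_rw [h3, Finset.sum_add_distrib, h1]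
    rw [← hXdef]; ring
  have hle : X * ((1 + X) * d b + Z.reroot b) ≤
      ∑ t, Z.ind t v * (w t * ((1 + X) * d t + Z.reroot t)) := by
    rw [← hsumw, Finset.sum_mul, hsumw]
    refine Finset.sum_le_sum fun t _ => ?_
    rw [mul_assoc]
    by_cases ht : Z.top t = v
    · exact mul_le_mul_of_nonneg_left (mul_le_mul_of_nonneg_left (hmin t ht) (hw t))
        (Z.ind_nonneg t v)
    · have h0 : Z.ind t v = 0 := by rw [Z.ind_eq_ite hk, if_neg ht]
      simp [h0]
  have hcost : d b + ∑ s, Z.ind s v * (w s * (d b + Z.clusterDist b s)) =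
      (1 + X) * d b + Z.reroot b + (∑ f, Z.ind f v * (Z.load f * c f) - X * c v) := by
    have h1 : ∀ s, Z.ind s v * (w s * (d b + Z.clusterDist b s)) =
        (Z.ind s v * w s) * d b + Z.ind s v * (w s * Z.clusterDist b s) := fun s => by ring
    simp_rw [h1, Finset.sum_add_distrib, ← Finset.sum_mul, hsumw, Z.sum_clusterDist hk hb, hB]
    rw [← hXdef]; ring
  rw [hcost]
  refine le_of_mul_le_mul_left ?_ hX
  rw [Z.edgeScore_eq_sum] at hexc
  have hfin : ∑ s, Z.ind s v * ((1 + X) * (w s * d s)) +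
      ∑ f, Z.ind f v * ((X - 2 * Z.load f) * Z.load f * c f) +
      X * ∑ f, Z.ind f v * (Z.load f * c f) -
      X * ∑ s, Z.ind s v * ((1 + 1 / μ) * (w s * d s) + μ / 2 * c s) =
      ∑ s, Z.ind s v * (w s * d s - 2 * Z.load s ^ 2 * c s) +
      X * ∑ s, Z.ind s v * ((2 * Z.load s - μ / 2) * c s - w s * d s / μ) := by
    simp_rw [Finset.mul_sum, ← Finset.sum_add_distrib, ← Finset.sum_sub_distrib]
    refine Finset.sum_congr rfl fun s _ => ?_
    ring
  rw [mul_add, mul_sub]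
  linarith

/-- The delay in the cluster that contains the root. -/
theorem root_cluster_cost_le (hw : ∀ v, 0 ≤ w v) (hd : ∀ v, 0 ≤ d v) (hc : ∀ v, 0 ≤ c v)
    (hc0 : c 0 = 0) (hμ : 0 < μ) :
    ∑ s, Z.ind s 0 * (w s * Z.clusterDist 0 s) ≤
      ∑ s, Z.ind s 0 * ((1 + 1 / μ) * (w s * d s) + μ / 2 * c s) := by
  classical
  have hk : ¬ Z.Kept 0 := fun h => h.1 rfl
  have hes : Z.edgeScore 0 ≤ 0 := by
    have := Z.score_nonpos hw hd hμ 0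
    unfold edgeScore; rw [hc0]; linarith
  rw [Z.edgeScore_eq_sum] at hes
  rw [Z.sum_clusterDist hk Z.top_zero, Z.sum_ind_kept hk, hc0, Z.reroot_zero]
  have h1 : ∑ f, Z.ind f 0 * (Z.load f * c f) ≤
      ∑ s, Z.ind s 0 * ((1 + 1 / μ) * (w s * d s) + μ / 2 * c s) +
      ∑ s, Z.ind s 0 * ((2 * Z.load s - μ / 2) * c s - w s * d s / μ) := by
    rw [← Finset.sum_add_distrib]
    refine Finset.sum_le_sum fun s _ => ?_
    rw [← mul_add]
    refine mul_le_mul_of_nonneg_left ?_ (Z.ind_nonneg s 0)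
    have h2 := mul_nonneg (Z.load_nonneg hw s) (hc s)
    have h3 := mul_nonneg (hw s) (hd s)
    have : (1 + 1 / μ) * (w s * d s) + μ / 2 * c s + ((2 * Z.load s - μ / 2) * c s - w s * d s / μ)
      = w s * d s + 2 * (Z.load s * c s) := by ring
    rw [this]; linarith
  linarith

open Classical in
/-- The bound on the objective value, for a quantity `P` that bounds distances in the new tree, in
which the edge above the top `v` of a cluster is replaced by an edge from the root to `best v`. -/
theorem cost_le (hw : ∀ v, 0 ≤ w v) (hd : ∀ v, 0 ≤ d v) (hc : ∀ v, 0 ≤ c v)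
    (hc0 : c 0 = 0) (hμ : 0 < μ) {best : Fin (N + 1) → Fin (N + 1)}
    (hbest : ∀ v, v ≠ 0 → ¬ Z.Kept v → Z.top (best v) = v ∧ ∀ s, Z.top s = v →
      (1 + Z.load v) * d (best v) + Z.reroot (best v) ≤ (1 + Z.load v) * d s + Z.reroot s)
    {P : Fin (N + 1) → Fin (N + 1) → ℝ} (hself : ∀ v, P v v = 0)
    (hl : ∀ t s, Z.Kept t → P t s ≤ c t + P (T.parent t) s)
    (hr : ∀ t s, Z.Kept s → P t s ≤ c s + P t (T.parent s))
    (hroot : ∀ v s, v ≠ 0 → ¬ Z.Kept v → P 0 s ≤ d (best v) + P (best v) s) :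
    (∑ v, if v = 0 then 0 else if Z.Kept v then c v else d (best v)) + ∑ s, w s * P 0 s ≤
      (1 + μ / 2) * ∑ v, c v + (1 + 1 / μ) * ∑ v, w v * d v := by
  -- The cost of the cluster with top `v`.
  have hcl : ∀ v, ¬ Z.Kept v → (if v = 0 then 0 else d (best v)) +
      ∑ s, Z.ind s v * (w s * P 0 s) ≤
      ∑ s, Z.ind s v * ((1 + 1 / μ) * (w s * d s) + μ / 2 * c s) := by
    intro v hk
    by_cases hv : v = 0
    · subst hv
      rw [if_pos rfl, zero_add]
      refine le_trans (Finset.sum_le_sum fun s _ => ?_) (Z.root_cluster_cost_le hw hd hc hc0 hμ)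
      by_cases hs : Z.top s = 0
      · refine mul_le_mul_of_nonneg_left (mul_le_mul_of_nonneg_left ?_ (hw s)) (Z.ind_nonneg s 0)
        exact Z.le_clusterDist hself hl hr (by rw [hs, Z.top_zero])
      · simp [Z.ind_eq_ite hk, hs]
    · rw [if_neg hv]
      obtain ⟨hb, hmin⟩ := hbest v hv hk
      refine le_trans (add_le_add_right (Finset.sum_le_sum fun s _ => ?_) _)
        (Z.cluster_cost_le hw hd hc hμ hv hk hb hmin)
      by_cases hs : Z.top s = v
      · refine mul_le_mul_of_nonneg_left (mul_le_mul_of_nonneg_left ?_ (hw s)) (Z.ind_nonneg s v)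
        exact (hroot v s hv hk).trans
          (add_le_add_right (Z.le_clusterDist hself hl hr (by rw [hs, hb])) _)
      · simp [Z.ind_eq_ite hk, hs]
  have hpart : ∀ g : Fin (N + 1) → ℝ,
      (∑ v, if Z.Kept v then 0 else ∑ s, Z.ind s v * g s) = ∑ s, g s := by
    intro g
    have h1 : ∀ v, (if Z.Kept v then 0 else ∑ s, Z.ind s v * g s) =
        ∑ s, if Z.top s = v then g s else 0 := by
      intro v
      split_ifs with hk
      · symm
        refine Finset.sum_eq_zero fun s _ => if_neg ?_
        rintro rfl
        exact Z.not_kept_top s hk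
      · refine Finset.sum_congr rfl fun s _ => ?_
        rw [Z.ind_eq_ite hk]; split_ifs <;> simp
    simp_rw [h1]
    rw [Finset.sum_comm]
    simp
  have hsum := Finset.sum_le_sum fun v (_ : v ∈ Finset.univ) =>
    show (if Z.Kept v then 0 else (if v = 0 then 0 else d (best v)) +
        ∑ s, Z.ind s v * (w s * P 0 s)) ≤
      if Z.Kept v then 0 else ∑ s, Z.ind s v * ((1 + 1 / μ) * (w s * d s) + μ / 2 * c s) by
      split_ifs with hk h0
      · exact le_rfl
      · have := hcl v hk; rwa [if_pos h0] at this
      · have := hcl v hk; rwa [if_neg h0] at this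
  rw [hpart] at hsum
  have hsplit : (∑ v, if Z.Kept v then 0 else (if v = 0 then 0 else d (best v)) +
        ∑ s, Z.ind s v * (w s * P 0 s)) =
      (∑ v, if Z.Kept v then 0 else if v = 0 then 0 else d (best v)) + ∑ s, w s * P 0 s := by
    rw [← hpart (fun s => w s * P 0 s), ← Finset.sum_add_distrib]
    refine Finset.sum_congr rfl fun v _ => ?_
    split_ifs <;> simp
  have hconn : (∑ v, if v = 0 then 0 else if Z.Kept v then c v else d (best v)) ≤
      (∑ v, if Z.Kept v then 0 else if v = 0 then 0 else d (best v)) + ∑ v, c v := by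
    rw [← Finset.sum_add_distrib]
    refine Finset.sum_le_sum fun v _ => ?_
    have := hc v
    split_ifs <;> linarith
  rw [hsplit, Finset.sum_add_distrib, ← Finset.mul_sum, ← Finset.mul_sum] at hsum
  linarith

end Clustering

/-! ### Orienting a tree given by its list of edges, and lengths of paths -/

section

/-- A rooted tree whose parent edges are the pairs `{l i, r i}`: `edge v` is the number of the edge
above `v` and `child i` the lower end of the edge `i`. -/
structure Orientation {N : ℕ} (l r : Fin N → Fin (N + 1)) extends RootedTree N where
  edge : Fin (N + 1) → ℕ
  child : ℕ → Fin (N + 1)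
  edge_zero : edge 0 = 0
  edge_lt : ∀ v, v ≠ 0 → edge v < N
  child_edge : ∀ v, v ≠ 0 → child (edge v) = v
  child_ne : ∀ i, i < N → child i ≠ 0
  edge_child : ∀ i, i < N → edge (child i) = i
  ends : ∀ i : Fin N, (l i = child i ∧ r i = parent (child i)) ∨
    (l i = parent (child i) ∧ r i = child i)

namespace Orientation

variable {N : ℕ} {l r : Fin N → Fin (N + 1)} (T : Orientation l r)

theorem sum_edges {α : Type*} [AddCommMonoid α] (g : ℕ → α) :
    ∑ i ∈ Finset.range N, g i = ∑ v, if v = 0 then 0 else g (T.edge v) := by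
  classical
  have h1 : (∑ v, if v = 0 then 0 else g (T.edge v)) =
      ∑ v ∈ Finset.univ.filter (fun v : Fin (N + 1) => v ≠ 0), g (T.edge v) := by
    rw [Finset.sum_filter]
    refine Finset.sum_congr rfl fun v _ => ?_
    by_cases hv : v = 0 <;> simp [hv]
  rw [h1]
  refine Finset.sum_nbij' T.child T.edge ?_ ?_ ?_ ?_ ?_
  · intro i hi; simpa using T.child_ne i (by simpa using hi)
  · intro v hv; simpa using T.edge_lt v (by simpa using hv)
  · intro i hi; exact T.edge_child i (by simpa using hi)
  · intro v hv; exact T.child_edge v (by simpa using hv)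
  · intro i hi; rw [T.edge_child i (by simpa using hi)]

theorem parent_ne {v : Fin (N + 1)} (hv : v ≠ 0) : T.parent v ≠ v := by
  intro h
  have := T.depth_eq v hv
  rw [h] at this; omega

/-- Every list of `N` edges of a connected graph on `N + 1` vertices can be oriented towards the
root, along shortest paths. -/
theorem nonempty {G : SimpleGraph (Fin (N + 1))} (hG : G.Connected)
    (hlr : ∀ x y, G.Adj x y ↔ ∃ i, (l i = x ∧ r i = y) ∨ (l i = y ∧ r i = x)) :
    Nonempty (Orientation l r) := by
  classical
  have hpar : ∀ v, ∃ u, v ≠ 0 → G.Adj v u ∧ G.dist v 0 = G.dist u 0 + 1 := by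
    intro v
    by_cases hv : v = 0
    · exact ⟨0, fun h => absurd hv h⟩
    · obtain ⟨p, hp⟩ := hG.exists_walk_length_eq_dist v 0
      cases p with
      | nil => exact absurd rfl hv
      | cons h q =>
        rename_i u
        refine ⟨u, fun _ => ⟨h, ?_⟩⟩
        rw [SimpleGraph.Walk.length_cons] at hp
        have h1 := SimpleGraph.dist_le q
        have h2 := hG.dist_triangle (u := v) (v := u) (w := 0)
        rw [SimpleGraph.dist_eq_one_iff_adj.2 h] at h2
        omega
  choose par hpar using hpar
  have hedge : ∀ v : {v : Fin (N + 1) // v ≠ 0}, ∃ i : Fin N,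
      (l i = v ∧ r i = par v) ∨ (l i = par v ∧ r i = v) := by
    intro v
    obtain ⟨i, hi⟩ := (hlr _ _).1 (hpar v v.2).1
    exact ⟨i, hi⟩
  choose e he using hedge
  have hinj : Function.Injective e := by
    intro u v huv
    have h1 := he u
    have h2 := he v
    rw [huv] at h1
    have h3 := (hpar u u.2).2
    have h4 := (hpar v v.2).2
    apply Subtype.ext
    rcases h1 with ⟨h1, h1'⟩ | ⟨h1, h1'⟩ <;> rcases h2 with ⟨h2, h2'⟩ | ⟨h2, h2'⟩
    · rw [← h1, h2]
    · rw [← h1', h2', ← h1, h2] at h3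
      omega
    · rw [← h1, h2, ← h1', h2'] at h3
      omega
    · rw [← h1', h2']
  have hcard : Fintype.card {v : Fin (N + 1) // v ≠ 0} = Fintype.card (Fin N) := by
    simp
  let q := Equiv.ofBijective e ((Fintype.bijective_iff_injective_and_card e).2 ⟨hinj, hcard⟩)
  have hq : ∀ v, q v = e v := fun v => rfl
  have hchild : ∀ i (hi : i < N), (if h : i < N then ((q.symm ⟨i, h⟩ : _) : Fin (N + 1)) else 0)
      = q.symm ⟨i, hi⟩ := fun i hi => dif_pos hi
  refine ⟨{
    parent := fun v => if v = 0 then 0 else par v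
    depth := fun v => G.dist v 0
    parent_zero := if_pos rfl
    depth_eq := fun v hv => by rw [if_neg hv]; exact (hpar v hv).2
    edge := fun v => if hv : v ≠ 0 then e ⟨v, hv⟩ else 0
    child := fun i => if h : i < N then (q.symm ⟨i, h⟩ : _) else 0
    edge_zero := by simp
    edge_lt := fun v hv => by simp [hv]
    child_edge := fun v hv => by
      simp only [hv, ne_eq, not_false_eq_true, dif_pos, Fin.is_lt, Fin.eta]
      rw [← hq, Equiv.symm_apply_apply]
    child_ne := fun i hi => by rw [hchild i hi]; exact (q.symm ⟨i, hi⟩).2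
    edge_child := fun i hi => by
      rw [hchild i hi, dif_pos (q.symm ⟨i, hi⟩).2]
      simp only [Subtype.coe_eta]
      rw [← hq, Equiv.apply_symm_apply]
    ends := fun i => by
      have h1 := he (q.symm i)
      rw [← hq, Equiv.apply_symm_apply] at h1
      rw [hchild i i.2, if_neg (q.symm ⟨i, i.2⟩).2]
      exact h1 }⟩

end Orientation

variable {M : Type*} [PseudoMetricSpace M] {I : Problem M}

theorem SteinerTree.edgeLength_nonneg (A : SteinerTree I) (e : Sym2 A.Vertex) :
    0 ≤ A.edgeLength e := by
  induction e with
  | _ x y => exact dist_nonneg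

/-- The path in a tree is not longer than any other walk. -/
theorem SteinerTree.pathLength_le_walk (A : SteinerTree I) {x y : A.Vertex} (p : A.graph.Walk x y) :
    A.pathLength x y ≤ (p.edges.map A.edgeLength).sum := by
  classical
  have h := (A.isTree.existsUnique_path x y).choose_spec
  have h1 : (A.isTree.existsUnique_path x y).choose = p.bypass := (h.2 _ p.bypass_isPath).symm
  unfold pathLength
  rw [h1]
  obtain ⟨m, hm, hs⟩ := List.subperm_of_subset p.bypass_isPath.isTrail.edges_nodup
    p.edges_bypass_subset_edges
  rw [← (hm.map A.edgeLength).sum_eq]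
  refine List.Sublist.sum_le_sum (hs.map _) fun a ha => ?_
  obtain ⟨e, _, rfl⟩ := List.mem_map.1 ha
  exact A.edgeLength_nonneg e

theorem SteinerTree.pathLength_self (A : SteinerTree I) (x : A.Vertex) : A.pathLength x x = 0 := by
  refine le_antisymm (by simpa using A.pathLength_le_walk (SimpleGraph.Walk.nil (u := x))) ?_
  refine List.sum_nonneg fun a ha => ?_
  obtain ⟨e, _, rfl⟩ := List.mem_map.1 ha
  exact A.edgeLength_nonneg e

theorem SteinerTree.pathLength_cons_le (A : SteinerTree I) {x y z : A.Vertex}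
    (h : A.graph.Adj x y) :
    A.pathLength x z ≤ dist (A.pos x) (A.pos y) + A.pathLength y z := by
  refine (A.pathLength_le_walk
    (SimpleGraph.Walk.cons h (A.isTree.existsUnique_path y z).choose)).trans ?_
  rw [SimpleGraph.Walk.edges_cons, List.map_cons, List.sum_cons]
  exact le_rfl

theorem SteinerTree.pathLength_concat_le (A : SteinerTree I) {x y z : A.Vertex}
    (h : A.graph.Adj y z) :
    A.pathLength x z ≤ dist (A.pos y) (A.pos z) + A.pathLength x y := by
  refine (A.pathLength_le_walk
    ((A.isTree.existsUnique_path x y).choose.concat h)).trans ?_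
  rw [SimpleGraph.Walk.edges_concat, List.concat_eq_append, List.map_append, List.sum_append,
    add_comm]
  simp [edgeLength, pathLength]

/-- A tree has as many edges as the list has entries, so every edge is listed once. -/
theorem EdgeList.connectionCost_eq {A : SteinerTree I} (E : EdgeList A) :
    A.connectionCost = ∑ i, dist (A.pos (E.left i)) (A.pos (E.right i)) := by
  classical
  have hcard : A.graph.edgeFinset.card = I.numSinks + A.numSteiner := by
    have := A.isTree.card_edgeFinset
    simp at this; omega
  have himg : Finset.univ.image (fun i => s(E.left i, E.right i)) = A.graph.edgeFinset := by
    ext e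
    induction e with
    | _ x y =>
      simp only [Finset.mem_image, Finset.mem_univ, true_and, SimpleGraph.mem_edgeFinset,
        SimpleGraph.mem_edgeSet, E.adj_iff, Sym2.eq_iff]
  have hinj : Set.InjOn (fun i => s(E.left i, E.right i))
      (Finset.univ : Finset (Fin (I.numSinks + A.numSteiner))) := by
    rw [← Finset.card_image_iff, himg, hcard]; simp
  have h1 : A.connectionCost = ∑ e ∈ A.graph.edgeFinset, A.edgeLength e := by
    unfold SteinerTree.connectionCost
    refine Finset.sum_congr ?_ fun _ _ => rfl
    ext; simp
  rw [h1, ← himg, Finset.sum_image hinj]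
  rfl

/-- A connected graph on `N + 1` vertices with `N` edges is a tree. -/
theorem isTree_of_edges {N : ℕ} {G : SimpleGraph (Fin (N + 1))} (hG : G.Connected)
    {l r : Fin N → Fin (N + 1)}
    (hlr : ∀ x y, G.Adj x y → ∃ i, (l i = x ∧ r i = y) ∨ (l i = y ∧ r i = x)) : G.IsTree := by
  classical
  rw [SimpleGraph.isTree_iff_connected_and_card]
  refine ⟨hG, le_antisymm ?_ (hG.card_vert_le_card_edgeSet_add_one)⟩
  have h1 : G.edgeFinset ⊆ Finset.univ.image (fun i => s(l i, r i)) := by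
    intro e he
    induction e with
    | _ x y =>
      have := hlr x y (by simpa using he)
      simpa [Sym2.eq_iff] using this
  have h2 := Finset.card_le_card h1
  have h3 : (Finset.univ.image (fun i => s(l i, r i))).card ≤ N :=
    Finset.card_image_le.trans (by simp)
  rw [Nat.card_eq_fintype_card, ← SimpleGraph.edgeFinset_card]
  simp; omega

end

/-! ### The reconnected tree -/

section

variable {M : Type*} {I : Problem M}

namespace SteinerTree

/-- The delay weight of a vertex; it is zero for the root and for the Steiner vertices. -/
noncomputable def vertexWeight (A : SteinerTree I) (v : A.Vertex) : ℝ :=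
  if h : 1 ≤ (v : ℕ) ∧ (v : ℕ) ≤ I.numSinks then (I.weight ⟨v - 1, by omega⟩ : ℝ) else 0

theorem vertexWeight_nonneg (A : SteinerTree I) (v : A.Vertex) : 0 ≤ A.vertexWeight v := by
  unfold vertexWeight
  split_ifs
  · exact NNReal.coe_nonneg _
  · exact le_rfl

theorem sum_vertexWeight (A : SteinerTree I) (g : A.Vertex → ℝ) :
    ∑ v, A.vertexWeight v * g v = ∑ t, (I.weight t : ℝ) * g (A.sink t) := by
  symm
  refine Fintype.sum_of_injective A.sink (fun s t h => ?_) _ _ (fun v hv => ?_) (fun t => ?_)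
  · have := congrArg Fin.val h
    simp only [sink] at this
    exact Fin.ext (by omega)
  · have : ¬ (1 ≤ (v : ℕ) ∧ (v : ℕ) ≤ I.numSinks) := by
      intro h
      refine hv ⟨⟨v - 1, by omega⟩, Fin.ext ?_⟩
      simp only [sink]; omega
    simp [vertexWeight, this]
  · congr 1
    have : 1 ≤ ((A.sink t : A.Vertex) : ℕ) ∧ ((A.sink t : A.Vertex) : ℕ) ≤ I.numSinks := by
      simp only [sink]; omega
    rw [vertexWeight, dif_pos this]
    simp [sink]

variable [PseudoMetricSpace M]

/-- The length of the edge from a vertex to its parent. -/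
noncomputable def parentDist (A : SteinerTree I) (T : RootedTree (I.numSinks + A.numSteiner))
    (v : A.Vertex) : ℝ := dist (A.pos v) (A.pos (T.parent v))

/-- The distance of a vertex from the root in the metric space. -/
noncomputable def rootDist (A : SteinerTree I) (v : A.Vertex) : ℝ := dist (A.pos 0) (A.pos v)

end SteinerTree

variable [PseudoMetricSpace M]

/-- The tree in which the edge above the top `v` of every cluster that does not contain the root is
replaced by an edge from the root to `best v`. -/
theorem exists_reconnected {A : SteinerTree I} (E : EdgeList A) (T : Orientation E.left E.right)
    {μ : ℝ} (hμ : 0 < μ)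
    (Z : Clustering T.toRootedTree (A.parentDist T.toRootedTree) A.rootDist A.vertexWeight μ)
    {best : A.Vertex → A.Vertex}
    (hbest : ∀ v, v ≠ 0 → ¬ Z.Kept v → Z.top (best v) = v ∧ ∀ s, Z.top s = v →
      (1 + Z.load v) * A.rootDist (best v) + Z.reroot (best v) ≤
        (1 + Z.load v) * A.rootDist s + Z.reroot s) :
    ∃ (A' : SteinerTree I) (E' : EdgeList A'),
      (∀ σ : Memory M, σ.nat 1 0 = A.numSteiner →
        (∀ i : Fin (I.numSinks + A.numSteiner),
          (Z.Kept (T.child i) → σ.nat 2 i = E.left i ∧ σ.nat 3 i = E.right i) ∧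
          (¬ Z.Kept (T.child i) → σ.nat 2 i = 0 ∧ σ.nat 3 i = best (T.child i))) →
        (∀ v : A.Vertex, σ.point 1 v = A.pos v) → σ.Holds A' E') ∧
      A'.objective ≤ (1 + μ / 2) * A.connectionCost + (1 + 1 / μ) * I.minDelay := by
  classical
  let l : Fin (I.numSinks + A.numSteiner) → A.Vertex :=
    fun i => if Z.Kept (T.child i) then E.left i else 0
  let r : Fin (I.numSinks + A.numSteiner) → A.Vertex :=
    fun i => if Z.Kept (T.child i) then E.right i else best (T.child i)
  have hbest0 : ∀ v, v ≠ 0 → ¬ Z.Kept v → best v ≠ 0 := by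
    intro v hv hk h
    have := (hbest v hv hk).1
    rw [h, Z.top_zero] at this
    exact hv this.symm
  have hne : ∀ i, l i ≠ r i := by
    intro i
    have hc := T.child_ne i i.2
    by_cases hk : Z.Kept (T.child i)
    · simp only [l, r, hk, if_true]
      rcases T.ends i with ⟨h1, h2⟩ | ⟨h1, h2⟩ <;> rw [h1, h2]
      · exact (T.parent_ne hc).symm
      · exact T.parent_ne hc
    · simp only [l, r, hk, if_false]
      exact (hbest0 _ hc hk).symm
  let G : SimpleGraph A.Vertex :=
    { Adj := fun x y => ∃ i, (l i = x ∧ r i = y) ∨ (l i = y ∧ r i = x)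
      symm := ⟨fun x y ⟨i, hi⟩ => ⟨i, hi.symm⟩⟩
      loopless := ⟨fun x ⟨i, hi⟩ => hne i (by rcases hi with ⟨h, h'⟩ | ⟨h, h'⟩ <;> rw [h, h'])⟩ }
  have hadj_kept : ∀ v, Z.Kept v → G.Adj v (T.parent v) := by
    intro v hk
    have hlt := T.edge_lt v hk.1
    refine ⟨⟨T.edge v, hlt⟩, ?_⟩
    have h := T.ends ⟨T.edge v, hlt⟩
    simp only [T.child_edge v hk.1] at h
    simp only [l, r, T.child_edge v hk.1, hk, if_true]
    tauto
  have hadj_cut : ∀ v, v ≠ 0 → ¬ Z.Kept v → G.Adj 0 (best v) := by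
    intro v hv hk
    refine ⟨⟨T.edge v, T.edge_lt v hv⟩, Or.inl ?_⟩
    simp [l, r, T.child_edge v hv, hk]
  have hbelow : ∀ {s f}, Z.Below s f → G.Reachable s f := by
    intro s f h
    induction h with
    | refl => exact SimpleGraph.Reachable.refl _
    | tail _ hbc ih => exact ih.trans (hbc.2 ▸ (hadj_kept _ hbc.1).reachable)
  have hreach : ∀ v, G.Reachable v 0 := by
    intro v
    refine (hbelow (Z.below_top v)).trans ?_
    have hk := Z.not_kept_top v
    by_cases h0 : Z.top v = 0
    · rw [h0]
    · have h1 := hbelow (Z.below_top (best (Z.top v)))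
      rw [(hbest _ h0 hk).1] at h1
      exact h1.symm.trans (hadj_cut _ h0 hk).symm.reachable
  have hconn : G.Connected :=
    { preconnected := fun x y => (hreach x).trans (hreach y).symm
      nonempty := ⟨0⟩ }
  let A' : SteinerTree I :=
    { numSteiner := A.numSteiner
      graph := G
      isTree := isTree_of_edges hconn (l := l) (r := r) fun x y h => h
      pos := A.pos
      pos_root := A.pos_root
      pos_sink := A.pos_sink }
  let E' : EdgeList A' := { left := l, right := r, adj_iff := fun x y => Iff.rfl }
  refine ⟨A', E', fun σ h1 h2 h3 => ⟨h1, fun i => ?_, h3⟩, ?_⟩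
  · by_cases hk : Z.Kept (T.child i)
    · simpa [E', l, r, hk] using (h2 i).1 hk
    · simpa [E', l, r, hk] using (h2 i).2 hk
  have hcost := Z.cost_le A.vertexWeight_nonneg (fun v => dist_nonneg) (fun v => dist_nonneg)
    (by rw [SteinerTree.parentDist, T.parent_zero, dist_self]) hμ hbest
    (P := A'.pathLength) A'.pathLength_self
    (fun t s hk => A'.pathLength_cons_le (hadj_kept t hk))
    (fun t s hk => A'.pathLength_concat_le (x := t) (hadj_kept s hk).symm |>.trans
      (by rw [dist_comm]; exact le_rfl))
    (fun v s hv hk => A'.pathLength_cons_le (hadj_cut v hv hk))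
  have hC' : A'.connectionCost = ∑ v, if v = 0 then 0 else
      if Z.Kept v then A.parentDist T.toRootedTree v else A.rootDist (best v) := by
    rw [E'.connectionCost_eq]
    have h := T.sum_edges (fun i => if Z.Kept (T.child i) then
      A.parentDist T.toRootedTree (T.child i) else A.rootDist (best (T.child i)))
    rw [Finset.sum_range] at h
    have h' : ∀ v, (if v = 0 then 0 else if Z.Kept v then A.parentDist T.toRootedTree v
        else A.rootDist (best v)) = if v = 0 then 0 else if Z.Kept (T.child (T.edge v)) then
        A.parentDist T.toRootedTree (T.child (T.edge v))
        else A.rootDist (best (T.child (T.edge v))) := by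
      intro v
      by_cases hv : v = 0
      · simp [hv]
      · rw [T.child_edge v hv]
    rw [Finset.sum_congr rfl fun v _ => h' v]
    rw [← h]
    refine Finset.sum_congr rfl fun i _ => ?_
    change dist (A.pos (l i)) (A.pos (r i)) = _
    by_cases hk : Z.Kept (T.child i)
    · simp only [l, r, hk, if_true, SteinerTree.parentDist]
      rcases T.ends i with ⟨h1, h2⟩ | ⟨h1, h2⟩ <;> rw [h1, h2]
      exact dist_comm _ _
    · simp only [l, r, hk, if_false, SteinerTree.rootDist]
  have hC : A.connectionCost = ∑ v, A.parentDist T.toRootedTree v := by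
    rw [E.connectionCost_eq]
    have h := T.sum_edges (fun i => A.parentDist T.toRootedTree (T.child i))
    rw [Finset.sum_range] at h
    have h' : ∀ v, A.parentDist T.toRootedTree v = if v = 0 then 0 else
        A.parentDist T.toRootedTree (T.child (T.edge v)) := by
      intro v
      by_cases hv : v = 0
      · rw [if_pos hv, hv, SteinerTree.parentDist, T.parent_zero, dist_self]
      · rw [if_neg hv, T.child_edge v hv]
    rw [Finset.sum_congr rfl fun v _ => h' v]
    rw [← h]
    refine Finset.sum_congr rfl fun i _ => ?_
    simp only [SteinerTree.parentDist]
    rcases T.ends i with ⟨h1, h2⟩ | ⟨h1, h2⟩ <;> rw [h1, h2]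
    exact dist_comm _ _
  have hdelay : A'.delayCost = ∑ s, A.vertexWeight s * A'.pathLength 0 s :=
    (A'.sum_vertexWeight (fun s => A'.pathLength 0 s)).symm
  have hD : I.minDelay = ∑ v, A.vertexWeight v * A.rootDist v := by
    rw [A.sum_vertexWeight]
    refine Finset.sum_congr rfl fun t _ => ?_
    rw [SteinerTree.rootDist, A.pos_root, SteinerTree.sink, A.pos_sink]
  rw [SteinerTree.objective, hC', hdelay, hC, hD]
  exact hcost

end

/-! ### Reasoning about programs -/

section Memory

variable {M : Type*} (σ : Memory M)

@[simp] theorem Memory.nat_setNat (a i x b j : ℕ) :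
    (σ.setNat a i x).nat b j = if b = a ∧ j = i then x else σ.nat b j := by
  by_cases hb : b = a
  · subst hb
    by_cases hj : j = i <;> simp [Memory.setNat, Function.update, hj]
  · simp [Memory.setNat, Function.update, hb]

@[simp] theorem Memory.real_setReal (a i : ℕ) (x : ℝ) (b j : ℕ) :
    (σ.setReal a i x).real b j = if b = a ∧ j = i then x else σ.real b j := by
  by_cases hb : b = a
  · subst hb
    by_cases hj : j = i <;> simp [Memory.setReal, Function.update, hj]
  · simp [Memory.setReal, Function.update, hb]

@[simp] theorem Memory.real_setNat (a i x : ℕ) : (σ.setNat a i x).real = σ.real := rfl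
@[simp] theorem Memory.point_setNat (a i x : ℕ) : (σ.setNat a i x).point = σ.point := rfl
@[simp] theorem Memory.nat_setReal (a i : ℕ) (x : ℝ) : (σ.setReal a i x).nat = σ.nat := rfl
@[simp] theorem Memory.point_setReal (a i : ℕ) (x : ℝ) : (σ.setReal a i x).point = σ.point := rfl

end Memory

section Runs

variable {M : Type*} [PseudoMetricSpace M] {I : Problem M} {β : ℝ} {R : SubroutineRun I β}

/-- Started in `σ`, the program `P` halts after at most `k` steps in a memory that satisfies `Q`. -/
def Runs (R : SubroutineRun I β) (P : Program) (σ : Memory M) (k : ℕ) (Q : Memory M → Prop) :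
    Prop := ∃ j τ, j ≤ k ∧ Exec R P σ j τ ∧ Q τ

theorem Runs.mono {P : Program} {σ : Memory M} {k l : ℕ} {Q S : Memory M → Prop}
    (h : Runs R P σ k Q) (hkl : k ≤ l) (hQS : ∀ τ, Q τ → S τ) : Runs R P σ l S := by
  obtain ⟨j, τ, hj, he, hq⟩ := h
  exact ⟨j, τ, hj.trans hkl, he, hQS τ hq⟩

theorem Runs.skip {σ : Memory M} {Q : Memory M → Prop} (h : Q σ) :
    Runs R Program.skip σ 1 Q := ⟨1, σ, le_rfl, Exec.skip σ, h⟩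

theorem Runs.setNat {σ : Memory M} {a : ℕ} {i e : NatExpr} {Q : Memory M → Prop}
    (h : Q (σ.setNat a (i.eval σ) (e.eval σ))) : Runs R (Program.setNat a i e) σ 1 Q :=
  ⟨1, _, le_rfl, Exec.setNat σ a i e, h⟩

theorem Runs.setReal {σ : Memory M} {a : ℕ} {i : NatExpr} {e : RealExpr} {Q : Memory M → Prop}
    (h : Q (σ.setReal a (i.eval σ) (e.eval σ))) : Runs R (Program.setReal a i e) σ 1 Q :=
  ⟨1, _, le_rfl, Exec.setReal σ a i e, h⟩

theorem Runs.steiner {σ : Memory M} {Q : Memory M → Prop}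
    (h : Q (σ.store R.tree R.edges)) : Runs R Program.steiner σ R.time Q :=
  ⟨R.time, _, le_rfl, Exec.steiner σ, h⟩

theorem Runs.seq {P P' : Program} {σ : Memory M} {k l : ℕ} {Q : Memory M → Prop}
    (h : Runs R P σ k fun τ => Runs R P' τ l Q) : Runs R (Program.seq P P') σ (k + l) Q := by
  obtain ⟨j, τ, hj, he, j', τ', hj', he', hq⟩ := h
  exact ⟨j + j', τ', by omega, Exec.seq he he', hq⟩

theorem Runs.ite {b : Test} {P P' : Program} {σ : Memory M} {k : ℕ} {Q : Memory M → Prop}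
    (ht : b.Holds σ → Runs R P σ k Q) (hf : ¬ b.Holds σ → Runs R P' σ k Q) :
    Runs R (Program.ite b P P') σ (k + 1) Q := by
  by_cases hb : b.Holds σ
  · obtain ⟨j, τ, hj, he, hq⟩ := ht hb
    exact ⟨j + 1, τ, by omega, Exec.ite_true hb he, hq⟩
  · obtain ⟨j, τ, hj, he, hq⟩ := hf hb
    exact ⟨j + 1, τ, by omega, Exec.ite_false hb he, hq⟩

/-- A scalar variable. -/
def natVar (a : ℕ) : NatExpr := .cell a (.const 0)

/-- `for i = 0, …, n - 1 do P`, with `i` in cell `0` of the array `11` and `n` in cell `0` of the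
array `10`. -/
def forLoop (P : Program) : Program :=
  .seq (.setNat 11 (.const 0) (.const 0))
    (.loop (.natLt (natVar 11) (natVar 10))
      (.seq P (.setNat 11 (.const 0) (.add (natVar 11) (.const 1)))))

theorem Runs.forLoop {P : Program} {n c : ℕ} {Inv : ℕ → Memory M → Prop}
    (hn : ∀ k σ, Inv k σ → σ.nat 10 0 = n)
    (hbody : ∀ k σ, k < n → Inv k σ → σ.nat 11 0 = k →
      Runs R P σ c fun τ => τ.nat 11 0 = k ∧ Inv (k + 1) (τ.setNat 11 0 (k + 1)))
    {σ : Memory M} (h0 : Inv 0 (σ.setNat 11 0 0)) :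
    Runs R (CostDistance.forLoop P) σ ((c + 2) * n + 2) (Inv n) := by
  have key : ∀ m k τ, k + m = n → Inv k τ → τ.nat 11 0 = k →
      Runs R (.loop (.natLt (natVar 11) (natVar 10))
        (.seq P (.setNat 11 (.const 0) (.add (natVar 11) (.const 1))))) τ
        ((c + 2) * m + 1) (Inv n) := by
    intro m
    induction m with
    | zero =>
      intro k τ hk hI hi
      have h10 := hn k τ hI
      have hkn : k = n := by omega
      subst hkn
      refine ⟨1, τ, by omega, Exec.loop_false ?_, hI⟩
      simp [Test.Holds, NatExpr.eval, natVar, h10, hi]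
    | succ m ih =>
      intro k τ hk hI hi
      have h10 := hn k τ hI
      obtain ⟨j, ρ, hj, he, hρ, hI'⟩ := hbody k τ (by omega) hI hi
      obtain ⟨j', ρ', hj', he', hI''⟩ := ih (k + 1) _ (by omega) hI' (by simp)
      have he2 : Exec R (.setNat 11 (.const 0) (.add (natVar 11) (.const 1))) ρ 1
          (ρ.setNat 11 0 (k + 1)) := by
        have := Exec.setNat (R := R) ρ 11 (.const 0) (.add (natVar 11) (.const 1))
        simpa [NatExpr.eval, natVar, hρ] using this
      refine ⟨j + 1 + j' + 1, ρ', ?_, Exec.loop_true ?_ (Exec.seq he he2) he', hI''⟩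
      · have : (c + 2) * (m + 1) = (c + 2) * m + (c + 2) := by ring
        omega
      · simp only [Test.Holds, NatExpr.eval, natVar, h10, hi]; omega
  refine (Runs.seq (k := 1) (l := (c + 2) * n + 1) (Runs.setNat ?_)).mono (by omega)
    fun _ h => h
  exact key n 0 _ (by omega) h0 (by simp [NatExpr.eval])

end Runs

/-! ### The algorithm -/

/-- `cell a i` for a scalar index. -/
def natCell (a b : ℕ) : NatExpr := .cell a (natVar b)

/-- A real array cell with a scalar index. -/
def realCell (a b : ℕ) : RealExpr := .cell a (natVar b)

/-- For every vertex, count the incident edges in the array `4` and add up their numbers in the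
array `5`. -/
def countEdges : Program :=
  forLoop
    (.seq (.setNat 4 (natCell 2 11) (.add (.cell 4 (natCell 2 11)) (.const 1)))
    (.seq (.setNat 4 (natCell 3 11) (.add (.cell 4 (natCell 3 11)) (.const 1)))
    (.seq (.setNat 5 (natCell 2 11) (.add (.cell 5 (natCell 2 11)) (natVar 11)))
    (.setNat 5 (natCell 3 11) (.add (.cell 5 (natCell 3 11)) (natVar 11))))))

/-- Append the vertex expression `e` to the queue in the array `6`, of length `12`. -/
def push (e : NatExpr) : Program :=
  .seq (.setNat 6 (natVar 12) e) (.setNat 12 (.const 0) (.add (natVar 12) (.const 1)))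

/-- Put all leaves except the root into the queue. -/
def collectLeaves : Program :=
  .seq (.setNat 12 (.const 0) (.const 0))
    (forLoop (.ite (.natEq (.cell 4 (.add (natVar 11) (.const 1))) (.const 1))
      (push (.add (natVar 11) (.const 1))) .skip))

/-- Load a vertex into the scalar `13`, the edge above it into `14` and its parent into `15`.  The
parent is the other end of the edge. -/
def loadVertex (e : NatExpr) : Program :=
  .seq (.setNat 13 (.const 0) e)
  (.seq (.setNat 14 (.const 0) (natCell 5 13))
  (.setNat 15 (.const 0) (.sub (.add (natCell 2 14) (natCell 3 14)) (natVar 13))))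

/-- Remove the leaves one after the other; afterwards the queue lists all vertices but the root, and
the children of a vertex precede it. -/
def peelLeaves : Program :=
  forLoop
    (.seq (loadVertex (natCell 6 11))
    (.seq (.setNat 4 (natVar 15) (.sub (natCell 4 15) (.const 1)))
    (.seq (.setNat 5 (natVar 15) (.sub (natCell 5 15) (natVar 14)))
    (.ite (.and (.natEq (natCell 4 15) (.const 1)) (.not (.natEq (natVar 15) (.const 0))))
      (push (natVar 15)) .skip))))

/-! ### Peeling the leaves -/

section Peel

variable {M : Type*} {N : ℕ} {l r : Fin N → Fin (N + 1)}

/-- What the memory holds throughout: the size, the tree and the data of the instance. -/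
structure Base (T : Orientation l r) (s : ℕ) (pos : Fin (N + 1) → M) (w : Fin (N + 1) → ℝ) (μ : ℝ)
    (σ : Memory M) : Prop where
  size : σ.nat 10 0 = N
  steiner : σ.nat 1 0 = s
  left : ∀ i : Fin N, σ.nat 2 i = l i
  right : ∀ i : Fin N, σ.nat 3 i = r i
  point : ∀ v : Fin (N + 1), σ.point 1 v = pos v
  weight : ∀ v : Fin (N + 1), v ≠ 0 → σ.real 0 (v - 1) = w v
  threshold : σ.real 1 0 = μ

variable {T : Orientation l r} {s : ℕ} {pos : Fin (N + 1) → M} {w : Fin (N + 1) → ℝ} {μ : ℝ}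

theorem Base.setNat {σ : Memory M} (h : Base T s pos w μ σ) {a : ℕ} (ha : 4 ≤ a) (ha' : a ≠ 10)
    (i x : ℕ) : Base T s pos w μ (σ.setNat a i x) where
  size := by simpa [ha'.symm] using h.size
  steiner := by simpa [show 1 ≠ a by omega] using h.steiner
  left := by simpa [show 2 ≠ a by omega] using h.left
  right := by simpa [show 3 ≠ a by omega] using h.right
  point := by simpa using h.point
  weight := by simpa using h.weight
  threshold := by simpa using h.threshold

theorem Base.setReal {σ : Memory M} (h : Base T s pos w μ σ) {a : ℕ} (ha : 2 ≤ a)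
    (i : ℕ) (x : ℝ) : Base T s pos w μ (σ.setReal a i x) where
  size := by simpa using h.size
  steiner := by simpa using h.steiner
  left := by simpa using h.left
  right := by simpa using h.right
  point := by simpa using h.point
  weight := by simpa [show 0 ≠ a by omega] using h.weight
  threshold := by simpa [show 1 ≠ a by omega] using h.threshold

/-- The vertices other than the root that are not among the first `k` of the sequence `Q`. -/
def remaining (Q : ℕ → Fin (N + 1)) (k : ℕ) : Finset (Fin (N + 1)) :=
  Finset.univ.filter fun u => u ≠ 0 ∧ ∀ j, j < k → Q j ≠ u

theorem mem_remaining {Q : ℕ → Fin (N + 1)} {k : ℕ} {u : Fin (N + 1)} :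
    u ∈ remaining Q k ↔ u ≠ 0 ∧ ∀ j, j < k → Q j ≠ u := by
  simp [remaining]

theorem remaining_succ (Q : ℕ → Fin (N + 1)) (k : ℕ) :
    remaining Q (k + 1) = (remaining Q k).erase (Q k) := by
  ext u
  simp only [Finset.mem_erase, mem_remaining]
  constructor
  · rintro ⟨h1, h2⟩
    exact ⟨(h2 k (by omega)).symm, h1, fun j hj => h2 j (by omega)⟩
  · rintro ⟨h1, h2, h3⟩
    refine ⟨h2, fun j hj => ?_⟩
    rcases Nat.lt_succ_iff_lt_or_eq.1 hj with hj | rfl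
    · exact h3 j hj
    · exact h1.symm

theorem remaining_congr {Q Q' : ℕ → Fin (N + 1)} {k : ℕ} (h : ∀ j, j < k → Q j = Q' j) :
    remaining Q k = remaining Q' k := by
  ext u
  simp only [mem_remaining]
  exact and_congr_right fun _ => forall₂_congr fun j hj => by rw [h j hj]

/-- The edges that are left when only the vertices in `U` (and the root) remain: the degree of every
vertex is in the array `4`, the sum of the numbers of the incident edges in the array `5`. -/
structure Incidence (T : Orientation l r) (U : Finset (Fin (N + 1))) (σ : Memory M) : Prop where
  degree : ∀ v : Fin (N + 1), σ.nat 4 v =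
    (if v = 0 then 0 else 1) + ∑ u ∈ U, if T.parent u = v then 1 else 0
  edges : ∀ v : Fin (N + 1), σ.nat 5 v =
    T.edge v + ∑ u ∈ U, if T.parent u = v then T.edge u else 0

theorem Incidence.setNat {U : Finset (Fin (N + 1))} {σ : Memory M} (h : Incidence T U σ) {a : ℕ}
    (ha : 6 ≤ a) (i x : ℕ) : Incidence T U (σ.setNat a i x) where
  degree := by simpa [show 4 ≠ a by omega] using h.degree
  edges := by simpa [show 5 ≠ a by omega] using h.edges

/-- The queue holds the `m` distinct vertices `Q 0, …, Q (m - 1)`, and the children of each of them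
come before it. -/
structure Queue (T : Orientation l r) (Q : ℕ → Fin (N + 1)) (m : ℕ) (σ : Memory M) : Prop where
  cell : ∀ j, j < m → σ.nat 6 j = Q j
  ne_zero : ∀ j, j < m → Q j ≠ 0
  inj : ∀ i j, i < m → j < m → Q i = Q j → i = j
  order : ∀ j, j < m → ∀ c, c ≠ 0 → T.parent c = Q j → ∃ i, i < j ∧ Q i = c

theorem Queue.image_eq {Q : ℕ → Fin (N + 1)} {σ : Memory M} (h : Queue T Q N σ) :
    (Finset.range N).image Q = Finset.univ.erase 0 := by
  refine Finset.eq_of_subset_of_card_le (fun u hu => ?_) ?_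
  · obtain ⟨j, hj, rfl⟩ := Finset.mem_image.1 hu
    exact Finset.mem_erase.2 ⟨h.ne_zero j (by simpa using hj), Finset.mem_univ _⟩
  · rw [Finset.card_image_of_injOn, Finset.card_range]
    · simp
    · intro i hi j hj hij
      exact h.inj i j (by simpa using hi) (by simpa using hj) hij

theorem Queue.exists_eq {Q : ℕ → Fin (N + 1)} {σ : Memory M} (h : Queue T Q N σ)
    {u : Fin (N + 1)} (hu : u ≠ 0) : ∃ j, j < N ∧ Q j = u := by
  have : u ∈ (Finset.range N).image Q := by rw [h.image_eq]; simp [hu]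
  simpa using this

/-- A sum over the children of a vertex, in the order of the queue. -/
theorem Queue.sum_children {Q : ℕ → Fin (N + 1)} {σ : Memory M} (h : Queue T Q N σ)
    {α : Type*} [AddCommMonoid α] (g : Fin (N + 1) → α) (v : Fin (N + 1)) :
    (∑ u, if u ≠ 0 ∧ T.parent u = v then g u else 0) =
      ∑ j ∈ Finset.range N, if T.parent (Q j) = v then g (Q j) else 0 := by
  have h1 : (∑ u, if u ≠ 0 ∧ T.parent u = v then g u else 0) =
      ∑ u ∈ Finset.univ.erase 0, if T.parent u = v then g u else 0 := by
    rw [← Finset.sum_erase Finset.univ (a := (0 : Fin (N + 1))) (by simp)]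
    refine Finset.sum_congr rfl fun u hu => ?_
    simp [(Finset.mem_erase.1 hu).1]
  rw [h1, ← h.image_eq, Finset.sum_image]
  intro i hi j hj hij
  exact h.inj i j (by simpa using hi) (by simpa using hj) hij

/-- The children of a vertex precede it in the queue. -/
theorem Queue.sum_children_lt {Q : ℕ → Fin (N + 1)} {σ : Memory M} (h : Queue T Q N σ)
    {α : Type*} [AddCommMonoid α] (g : Fin (N + 1) → α) {k : ℕ} (hk : k < N) :
    (∑ u, if u ≠ 0 ∧ T.parent u = Q k then g u else 0) =
      ∑ j ∈ Finset.range k, if T.parent (Q j) = Q k then g (Q j) else 0 := by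
  rw [h.sum_children]
  symm
  refine Finset.sum_subset (fun j hj => ?_) fun j hj hjk => if_neg fun hp => ?_
  · simp only [Finset.mem_range] at hj ⊢; omega
  · simp only [Finset.mem_range] at hj hjk
    obtain ⟨i, hi, hij⟩ := h.order k hk (Q j) (h.ne_zero j hj) hp
    have := h.inj i j (by omega) hj hij
    omega

theorem Queue.setNat {Q : ℕ → Fin (N + 1)} {m : ℕ} {σ : Memory M} (h : Queue T Q m σ) {a : ℕ}
    (ha : a ≠ 6) (i x : ℕ) : Queue T Q m (σ.setNat a i x) :=
  { h with cell := by simpa [ha.symm] using h.cell }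

theorem Queue.setReal {Q : ℕ → Fin (N + 1)} {m : ℕ} {σ : Memory M} (h : Queue T Q m σ) {a : ℕ}
    (i : ℕ) (x : ℝ) : Queue T Q m (σ.setReal a i x) :=
  { h with cell := by simpa using h.cell }

theorem Queue.push {Q : ℕ → Fin (N + 1)} {m : ℕ} {σ : Memory M} (h : Queue T Q m σ)
    {u : Fin (N + 1)} (hu : u ≠ 0) (hnew : ∀ j, j < m → Q j ≠ u)
    (hord : ∀ c, c ≠ 0 → T.parent c = u → ∃ i, i < m ∧ Q i = c) :
    Queue T (Function.update Q m u) (m + 1) (σ.setNat 6 m u) := by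
  have hlt : ∀ j, j < m → Function.update Q m u j = Q j := fun j hj =>
    Function.update_of_ne hj.ne _ _
  have hm : Function.update Q m u m = u := Function.update_self _ _ _
  refine ⟨fun j hj => ?_, fun j hj => ?_, fun i j hi hj hij => ?_, fun j hj c hc hcj => ?_⟩
  · rcases Nat.lt_succ_iff_lt_or_eq.1 hj with hj | rfl
    · simp [hj.ne, h.cell j hj]
    · simp
  · rcases Nat.lt_succ_iff_lt_or_eq.1 hj with hj | rfl
    · rw [hlt j hj]; exact h.ne_zero j hj
    · rwa [hm]
  · rcases Nat.lt_succ_iff_lt_or_eq.1 hi with hi | rfl <;>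
      rcases Nat.lt_succ_iff_lt_or_eq.1 hj with hj | rfl
    · rw [hlt i hi, hlt j hj] at hij; exact h.inj i j hi hj hij
    · rw [hlt i hi, hm] at hij; exact absurd hij (hnew i hi)
    · rw [hlt j hj, hm] at hij; exact absurd hij.symm (hnew j hj)
    · rfl
  · rcases Nat.lt_succ_iff_lt_or_eq.1 hj with hj | rfl
    · rw [hlt j hj] at hcj
      obtain ⟨i, hi, hic⟩ := h.order j hj c hc hcj
      exact ⟨i, hi, by rw [hlt i (by omega), hic]⟩
    · rw [hm] at hcj
      obtain ⟨i, hi, hic⟩ := hord c hc hcj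
      exact ⟨i, hi, by rw [hlt i hi, hic]⟩

theorem Queue.exists_update {Q : ℕ → Fin (N + 1)} {m : ℕ} {u x : Fin (N + 1)} :
    (∃ j, j < m + 1 ∧ Function.update Q m u j = x) ↔ (∃ j, j < m ∧ Q j = x) ∨ u = x := by
  constructor
  · rintro ⟨j, hj, hjx⟩
    rcases Nat.lt_succ_iff_lt_or_eq.1 hj with hj | rfl
    · rw [Function.update_of_ne hj.ne] at hjx; exact Or.inl ⟨j, hj, hjx⟩
    · rw [Function.update_self] at hjx; exact Or.inr hjx
  · rintro (⟨j, hj, hjx⟩ | h)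
    · exact ⟨j, by omega, by rw [Function.update_of_ne hj.ne, hjx]⟩
    · exact ⟨m, by omega, by rw [Function.update_self, h]⟩

theorem Incidence.degree_eq_one {U : Finset (Fin (N + 1))} {σ : Memory M} (h : Incidence T U σ)
    {v : Fin (N + 1)} (hv : v ≠ 0) : σ.nat 4 v = 1 ↔ ∀ c ∈ U, T.parent c ≠ v := by
  rw [h.degree v, if_neg hv]
  simp

/-- The state of the peeling after `k` vertices have been removed: the queue holds the removed
vertices and the current leaves. -/
def PeelState (T : Orientation l r) (s : ℕ) (pos : Fin (N + 1) → M) (w : Fin (N + 1) → ℝ) (μ : ℝ)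
    (k : ℕ) (σ : Memory M) : Prop :=
  Base T s pos w μ σ ∧ ∃ (Q : ℕ → Fin (N + 1)) (m : ℕ), k ≤ m ∧ σ.nat 12 0 = m ∧
    Queue T Q m σ ∧ Incidence T (remaining Q k) σ ∧
    ∀ u, u ≠ 0 → ((∃ j, j < m ∧ Q j = u) ↔ ∀ c ∈ remaining Q k, T.parent c ≠ u)

/-- While vertices remain, a deepest one of them is a leaf; so the queue is not exhausted. -/
theorem lt_of_leaves_mem {Q : ℕ → Fin (N + 1)} {k m : ℕ} (hkm : k ≤ m) (hk : k < N)
    (hiff : ∀ u, u ≠ 0 → ((∃ j, j < m ∧ Q j = u) ↔ ∀ c ∈ remaining Q k, T.parent c ≠ u)) :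
    k < m := by
  by_contra hlt
  have hkm' : m = k := by omega
  subst hkm'
  have hne : (remaining Q m).Nonempty := by
    by_contra hemp
    rw [Finset.not_nonempty_iff_eq_empty] at hemp
    have hsub : Finset.univ.erase (0 : Fin (N + 1)) ⊆ (Finset.range m).image Q := by
      intro u hu
      have hu0 : u ≠ 0 := (Finset.mem_erase.1 hu).1
      by_contra hnot
      have : u ∈ remaining Q m := mem_remaining.2 ⟨hu0, fun j hj h => hnot
        (Finset.mem_image.2 ⟨j, Finset.mem_range.2 hj, h⟩)⟩
      rw [hemp] at this
      simp at this
    have h1 := Finset.card_le_card hsub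
    have h2 : ((Finset.range m).image Q).card ≤ m := Finset.card_image_le.trans (by simp)
    simp at h1
    omega
  obtain ⟨u, hu, hmax⟩ := (remaining Q m).exists_max_image T.depth hne
  obtain ⟨hu0, hu1⟩ := mem_remaining.1 hu
  obtain ⟨j, hj, hju⟩ := (hiff u hu0).2 fun c hc hcu => by
    have h1 := hmax c hc
    have h2 := T.depth_eq c (mem_remaining.1 hc).1
    rw [hcu] at h2; omega
  exact hu1 j hj hju

variable [PseudoMetricSpace M] {I : Problem M} {β : ℝ} {R : SubroutineRun I β}

theorem runs_countEdges {σ : Memory M} (h : Base T s pos w μ σ) (h4 : ∀ j, σ.nat 4 j = 0)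
    (h5 : ∀ j, σ.nat 5 j = 0) :
    Runs R countEdges σ (6 * N + 2) fun τ =>
      Base T s pos w μ τ ∧ Incidence T (Finset.univ.filter (· ≠ 0)) τ := by
  -- The contribution of the edge `j` at the vertex `v`, counted with the value `g`.
  let cnt : ℕ → Fin (N + 1) → ℕ → ℕ := fun j v g =>
    (if T.child j = v then g else 0) + (if T.parent (T.child j) = v then g else 0)
  refine (Runs.forLoop (n := N) (c := 4) (Inv := fun k τ => Base T s pos w μ τ ∧
    (∀ v : Fin (N + 1), τ.nat 4 v = ∑ j ∈ Finset.range k, cnt j v 1) ∧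
    ∀ v : Fin (N + 1), τ.nat 5 v = ∑ j ∈ Finset.range k, cnt j v j)
    (fun k τ hI => hI.1.size) ?_ ?_).mono le_rfl ?_
  · rintro k τ hk ⟨hB, hd, he⟩ hi
    have hl := hB.left ⟨k, hk⟩
    have hr := hB.right ⟨k, hk⟩
    simp only at hl hr
    have hends := T.ends ⟨k, hk⟩
    have hne : l ⟨k, hk⟩ ≠ r ⟨k, hk⟩ := by
      have := T.parent_ne (T.child_ne k hk)
      rcases hends with ⟨h1, h2⟩ | ⟨h1, h2⟩ <;> rw [h1, h2]
      · exact this.symm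
      · exact this
    refine Runs.seq (k := 1) (l := 3) (Runs.setNat (Runs.seq (k := 1) (l := 2) (Runs.setNat
      (Runs.seq (k := 1) (l := 1) (Runs.setNat (Runs.setNat ?_))))))
    simp only [natCell, natVar, NatExpr.eval, Memory.nat_setNat]
    simp only [hi, hl, hr, Nat.reduceEqDiff, false_and, if_false, true_and]
    refine ⟨?_, fun v => ?_, fun v => ?_⟩
    · exact ((((hB.setNat (by omega) (by omega) _ _).setNat (by omega) (by omega) _ _).setNat
        (by omega) (by omega) _ _).setNat (by omega) (by omega) _ _).setNat
        (by omega) (by omega) _ _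
    · rw [Finset.sum_range_succ, ← hd v]
      have hc : cnt k v 1 = (if v = l ⟨k, hk⟩ then 1 else 0) + (if v = r ⟨k, hk⟩ then 1 else 0) := by
        simp only [cnt]
        rcases hends with ⟨h1, h2⟩ | ⟨h1, h2⟩ <;> simp only at h1 h2 <;>
          rw [h1, h2] <;> simp only [eq_comm (a := v)]
        rw [add_comm]
      rw [hc]
      by_cases h1 : v = l ⟨k, hk⟩
      · subst h1; simp [hne, Fin.val_inj]
      · by_cases h2 : v = r ⟨k, hk⟩
        · subst h2; simp [hne.symm, Fin.val_inj]
        · simp [h1, h2, Fin.val_inj]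
    · rw [Finset.sum_range_succ, ← he v]
      have hc : cnt k v k = (if v = l ⟨k, hk⟩ then k else 0) + (if v = r ⟨k, hk⟩ then k else 0) := by
        simp only [cnt]
        rcases hends with ⟨h1, h2⟩ | ⟨h1, h2⟩ <;> simp only at h1 h2 <;>
          rw [h1, h2] <;> simp only [eq_comm (a := v)]
        rw [add_comm]
      rw [hc]
      by_cases h1 : v = l ⟨k, hk⟩
      · subst h1; simp [hne, Fin.val_inj]
      · by_cases h2 : v = r ⟨k, hk⟩
        · subst h2; simp [hne.symm, Fin.val_inj]
        · simp [h1, h2, Fin.val_inj]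
  · exact ⟨h.setNat (by omega) (by omega) _ _, by simp [h4], by simp [h5]⟩
  · rintro τ ⟨hB, hd, he⟩
    refine ⟨hB, ⟨fun v => ?_, fun v => ?_⟩⟩
    · rw [hd v, T.sum_edges, Finset.sum_filter]
      have h1 : (if v = 0 then 0 else 1) = ∑ u, if u = v then (if v = 0 then 0 else 1) else 0 := by
        simp
      rw [h1, ← Finset.sum_add_distrib]
      refine Finset.sum_congr rfl fun u _ => ?_
      by_cases hu : u = 0
      · subst hu
        by_cases hv : v = 0
        · simp [hv]
        · simp [Ne.symm hv]
      · simp only [hu, if_false, cnt, T.child_edge u hu, ne_eq, not_false_eq_true, if_true]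
        by_cases huv : u = v
        · subst huv; simp [hu]
        · simp [huv]
    · rw [he v, T.sum_edges, Finset.sum_filter]
      have h1 : T.edge v = ∑ u, if u = v then T.edge v else 0 := by
        simp
      rw [h1, ← Finset.sum_add_distrib]
      refine Finset.sum_congr rfl fun u _ => ?_
      by_cases hu : u = 0
      · subst hu
        by_cases hv : v = 0
        · simp [hv, T.edge_zero]
        · simp [Ne.symm hv]
      · simp only [hu, if_false, cnt, T.child_edge u hu, ne_eq, not_false_eq_true, if_true]
        by_cases huv : u = v
        · subst huv; simp
        · simp [huv]

theorem runs_collectLeaves {σ : Memory M} (h : Base T s pos w μ σ)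
    (hinc : Incidence T (Finset.univ.filter (· ≠ 0)) σ) :
    Runs R collectLeaves σ (5 * N + 3) (PeelState T s pos w μ 0) := by
  refine (Runs.seq (k := 1) (l := 5 * N + 2) (Runs.setNat ?_)).mono (by omega) fun _ h => h
  refine (Runs.forLoop (n := N) (c := 3) (Inv := fun k τ => Base T s pos w μ τ ∧
    Incidence T (Finset.univ.filter (· ≠ 0)) τ ∧
    ∃ (Q : ℕ → Fin (N + 1)) (m : ℕ), τ.nat 12 0 = m ∧ Queue T Q m τ ∧
    ∀ u, u ≠ 0 → ((∃ j, j < m ∧ Q j = u) ↔ (u : ℕ) ≤ k ∧ ∀ c, c ≠ 0 → T.parent c ≠ u))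
    (fun k τ hI => hI.1.size) ?_ ?_).mono (by omega) ?_
  · rintro k τ hk ⟨hB, hI, Q, m, hm, hQ, hiff⟩ hi
    let u : Fin (N + 1) := ⟨k + 1, by omega⟩
    have hu : u ≠ 0 := fun h => by have := congrArg Fin.val h; simp [u] at this
    have hdeg : τ.nat 4 (k + 1) = 1 ↔ ∀ c, c ≠ 0 → T.parent c ≠ u := by
      have := hI.degree_eq_one hu
      simpa [u] using this
    have hle : ∀ x : Fin (N + 1), (x : ℕ) ≤ k + 1 ↔ (x : ℕ) ≤ k ∨ u = x := by
      intro x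
      rw [Fin.ext_iff]
      simp only [u]; omega
    refine Runs.ite (k := 2) (fun ht => ?_) fun hf => ?_
    · have ht' : ∀ c, c ≠ 0 → T.parent c ≠ u := by
        rw [← hdeg]
        simpa [Test.Holds, NatExpr.eval, natVar, hi] using ht
      refine Runs.seq (k := 1) (l := 1) (Runs.setNat (Runs.setNat ?_))
      simp only [natVar, NatExpr.eval, Memory.nat_setNat]
      simp only [hi, hm, Nat.reduceEqDiff, false_and, if_false]
      refine ⟨by simp, ?_, ?_, Function.update Q m u, m + 1, by simp, ?_, fun x hx => ?_⟩
      · exact ((hB.setNat (by omega) (by omega) _ _).setNat (by omega) (by omega) _ _).setNat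
          (by omega) (by omega) _ _
      · exact ((hI.setNat (by omega) _ _).setNat (by omega) _ _).setNat (by omega) _ _
      · refine ((hQ.push hu (fun j hj hju => ?_) fun c hc hcu => absurd hcu (ht' c hc)).setNat
          (by omega) _ _).setNat (by omega) _ _
        have := ((hiff u hu).1 ⟨j, hj, hju⟩).1
        simp [u] at this
      · rw [Queue.exists_update, hiff x hx, hle]
        constructor
        · rintro (h | rfl)
          · exact ⟨Or.inl h.1, h.2⟩
          · exact ⟨Or.inr rfl, ht'⟩
        · rintro ⟨h | h, h'⟩
          · exact Or.inl ⟨h, h'⟩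
          · exact Or.inr h
    · have hf' : ¬ ∀ c, c ≠ 0 → T.parent c ≠ u := by
        rw [← hdeg]
        simpa [Test.Holds, NatExpr.eval, natVar, hi] using hf
      refine (Runs.skip ?_).mono (by omega) fun _ h => h
      refine ⟨hi, hB.setNat (by omega) (by omega) _ _, hI.setNat (by omega) _ _, Q, m,
        by simpa using hm, hQ.setNat (by omega) _ _, fun x hx => ?_⟩
      rw [hiff x hx, hle]
      constructor
      · exact fun h => ⟨Or.inl h.1, h.2⟩
      · rintro ⟨h | rfl, h'⟩
        · exact ⟨h, h'⟩
        · exact absurd h' hf'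
  · refine ⟨(h.setNat (by omega) (by omega) _ _).setNat (by omega) (by omega) _ _,
      (hinc.setNat (by omega) _ _).setNat (by omega) _ _, fun _ => 0, 0,
      by simp [NatExpr.eval], ⟨fun j hj => absurd hj (by omega), fun j hj => absurd hj (by omega),
        fun i j hi => absurd hi (by omega), fun j hj => absurd hj (by omega)⟩, fun u hu => ?_⟩
    refine ⟨fun ⟨j, hj, _⟩ => absurd hj (by omega), fun ⟨h0, _⟩ => absurd (Fin.ext ?_) hu⟩
    simpa using h0
  · rintro τ ⟨hB, hI, Q, m, hm, hQ, hiff⟩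
    have hrem : remaining Q 0 = Finset.univ.filter (· ≠ 0) := by
      ext; simp [mem_remaining]
    refine ⟨hB, Q, m, by omega, hm, hQ, by rwa [hrem], fun u hu => ?_⟩
    rw [hiff u hu, hrem]
    have := u.is_le
    simp [this]

/-- `loadVertex` finds the parent of a vertex. -/
theorem runs_loadVertex {σ : Memory M} (h : Base T s pos w μ σ) {e : NatExpr} {v : Fin (N + 1)}
    (hv : v ≠ 0) (he : e.eval σ = v) (hedge : σ.nat 5 v = T.edge v) {S : Memory M → Prop}
    (hS : S (((σ.setNat 13 0 v).setNat 14 0 (T.edge v)).setNat 15 0 (T.parent v))) :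
    Runs R (loadVertex e) σ 3 S := by
  refine Runs.seq (k := 1) (l := 2) (Runs.setNat (Runs.seq (k := 1) (l := 1)
    (Runs.setNat (Runs.setNat ?_))))
  have hlt := T.edge_lt v hv
  have hl := h.left ⟨T.edge v, hlt⟩
  have hr := h.right ⟨T.edge v, hlt⟩
  have hends := T.ends ⟨T.edge v, hlt⟩
  simp only [T.child_edge v hv] at hl hr hends
  have hsub : (l ⟨T.edge v, hlt⟩ : ℕ) + (r ⟨T.edge v, hlt⟩ : ℕ) - (v : ℕ) = T.parent v := by
    rcases hends with ⟨h1, h2⟩ | ⟨h1, h2⟩ <;> rw [h1, h2] <;> omega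
  simp only [natCell, natVar, NatExpr.eval, Memory.nat_setNat]
  simp only [he, hedge, hl, hr, hsub, Nat.reduceEqDiff, false_and, if_false, and_self, if_true]
  exact hS

theorem runs_peelLeaves {σ : Memory M} (h : PeelState T s pos w μ 0 σ) :
    Runs R peelLeaves σ (10 * N + 2) fun τ => Base T s pos w μ τ ∧
      (∀ v : Fin (N + 1), v ≠ 0 → τ.nat 5 v = T.edge v) ∧ ∃ Q, Queue T Q N τ := by
  refine (Runs.forLoop (n := N) (c := 8) (Inv := PeelState T s pos w μ)
    (fun k τ hI => hI.1.size) ?_ ?_).mono (by omega) ?_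
  · rintro k τ hk ⟨hB, Q, m, hkm, hm, hQ, hI, hiff⟩ hi
    have hlt := lt_of_leaves_mem hkm hk hiff
    set v := Q k with hv
    have hv0 : v ≠ 0 := hQ.ne_zero k hlt
    have hvrem : v ∈ remaining Q k := mem_remaining.2 ⟨hv0, fun j hj hjv => by
      have := hQ.inj j k (by omega) hlt hjv; omega⟩
    have hleaf := (hiff v hv0).1 ⟨k, hlt, rfl⟩
    -- Only the edge to the parent is left at `v`, so the sum of the edge numbers is this edge.
    have hedge : τ.nat 5 v = T.edge v := by
      rw [hI.edges v, Finset.sum_eq_zero, add_zero]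
      intro c hc
      rw [if_neg (hleaf c hc)]
    set u := T.parent v with hu
    have hsplit : ∀ g : Fin (N + 1) → ℕ, ∀ x, ∑ c ∈ remaining Q k, (if T.parent c = x then g c else 0)
        = (if u = x then g v else 0) +
          ∑ c ∈ remaining Q (k + 1), if T.parent c = x then g c else 0 := by
      intro g x
      rw [remaining_succ, ← Finset.add_sum_erase _ _ hvrem]
    have hI' : Incidence T (remaining Q (k + 1))
        ((τ.setNat 4 u (τ.nat 4 u - 1)).setNat 5 u (τ.nat 5 u - T.edge v)) := by
      refine ⟨fun x => ?_, fun x => ?_⟩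
      · have h1 := hI.degree x
        rw [hsplit] at h1
        by_cases hx : u = x
        · subst hx
          rw [if_pos rfl] at h1
          simp only [Memory.nat_setNat, Nat.reduceEqDiff, false_and, if_false, and_self, if_true]
          omega
        · rw [if_neg hx] at h1
          have : ¬ (x : ℕ) = u := fun h => hx (Fin.ext h.symm)
          simp only [Memory.nat_setNat, Nat.reduceEqDiff, if_false, this, and_false]
          omega
      · have h1 := hI.edges x
        rw [hsplit] at h1
        by_cases hx : u = x
        · subst hx
          rw [if_pos rfl] at h1
          simp only [Memory.nat_setNat, and_self, if_true]
          omega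
        · rw [if_neg hx] at h1
          have : ¬ (x : ℕ) = u := fun h => hx (Fin.ext h.symm)
          simp only [Memory.nat_setNat, Nat.reduceEqDiff, if_false, this, and_false]
          omega
    have hdeg := fun h0 => hI'.degree_eq_one (v := u) h0
    simp only [Memory.nat_setNat, Nat.reduceEqDiff, false_and, if_false, and_self, if_true] at hdeg
    have hunew : ∀ j, j < m → u ≠ 0 → Q j ≠ u := fun j hj h0 hju =>
      (hiff u h0).1 ⟨j, hj, hju⟩ v hvrem rfl
    have hother : ∀ x, x ≠ u → ((∀ c ∈ remaining Q k, T.parent c ≠ x) ↔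
        ∀ c ∈ remaining Q (k + 1), T.parent c ≠ x) := by
      intro x hx
      rw [remaining_succ]
      refine ⟨fun h c hc => h c (Finset.mem_of_mem_erase hc), fun h c hc => ?_⟩
      by_cases hcv : c = v
      · subst hcv; exact fun h => hx h.symm
      · exact h c (Finset.mem_erase.2 ⟨hcv, hc⟩)
    refine Runs.seq (k := 3) (l := 5) (runs_loadVertex hB hv0 (v := v) ?_ hedge ?_)
    · simp only [natCell, natVar, NatExpr.eval, hi, hQ.cell k hlt, ← hv]
    refine Runs.seq (k := 1) (l := 4) (Runs.setNat (Runs.seq (k := 1) (l := 3) (Runs.setNat ?_)))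
    simp only [natCell, natVar, NatExpr.eval, Memory.nat_setNat]
    simp only [← hu, Nat.reduceEqDiff, false_and, if_false, and_self, if_true]
    refine Runs.ite (k := 2) (fun ht => ?_) fun hf => ?_
    · simp only [Test.Holds, NatExpr.eval, Memory.nat_setNat, Nat.reduceEqDiff, false_and, if_false,
        and_self, if_true] at ht
      have hu0 : u ≠ 0 := fun h => ht.2 (by simp [h])
      have hdone := (hdeg hu0).1 ht.1
      refine Runs.seq (k := 1) (l := 1) (Runs.setNat (Runs.setNat ?_))
      simp only [natVar, NatExpr.eval, Memory.nat_setNat]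
      simp only [hi, hm, Nat.reduceEqDiff, false_and, if_false, and_self, if_true]
      have hrem : remaining (Function.update Q m u) (k + 1) = remaining Q (k + 1) :=
        remaining_congr fun j hj => Function.update_of_ne (by omega) _ _
      refine ⟨by simp, ?_, Function.update Q m u, m + 1, by omega, by simp, ?_, ?_,
        fun x hx => ?_⟩
      · iterate 8 refine Base.setNat ?_ (by omega) (by omega) _ _
        exact hB
      · refine (Queue.setNat ?_ (by omega) _ _).setNat (by omega) _ _
        refine Queue.push ?_ hu0 (fun j hj => hunew j hj hu0) fun c hc hcu => ?_
        · iterate 5 refine Queue.setNat ?_ (by omega) _ _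
          exact hQ
        · by_contra hnot
          refine hdone c (mem_remaining.2 ⟨hc, fun j hj hjc => hnot ⟨j, by omega, hjc⟩⟩) hcu
      · rw [hrem]
        iterate 3 refine Incidence.setNat ?_ (by omega) _ _
        refine ⟨?_, ?_⟩
        · simpa using hI'.degree
        · simpa using hI'.edges
      · rw [Queue.exists_update, hiff x hx, hrem]
        by_cases hxu : x = u
        · subst hxu
          exact ⟨fun _ => hdone, fun _ => Or.inr rfl⟩
        · rw [hother x hxu]
          exact ⟨fun h => h.resolve_right fun h => hxu h.symm, Or.inl⟩
    · simp only [Test.Holds, NatExpr.eval, Memory.nat_setNat, Nat.reduceEqDiff, false_and, if_false,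
        and_self, if_true, not_and, not_not] at hf
      refine (Runs.skip ?_).mono (by omega) fun _ h => h
      refine ⟨by simpa using hi, ?_, Q, m, by omega, by simpa using hm, ?_, ?_,
        fun x hx => ?_⟩
      · iterate 6 refine Base.setNat ?_ (by omega) (by omega) _ _
        exact hB
      · iterate 6 refine Queue.setNat ?_ (by omega) _ _
        exact hQ
      · refine Incidence.setNat ?_ (by omega) _ _
        refine ⟨?_, ?_⟩
        · simpa using hI'.degree
        · simpa using hI'.edges
      · rw [hiff x hx]
        by_cases hxu : x = u
        · refine ⟨fun h => absurd hxu.symm (h v hvrem), fun h => ?_⟩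
          have hu0 : u ≠ 0 := hxu ▸ hx
          exact absurd (Fin.ext (hf ((hdeg hu0).2 (hxu ▸ h)))) hu0
        · exact hother x hxu
  · obtain ⟨hB, Q, m, hkm, hm, hQ, hI, hiff⟩ := h
    exact ⟨hB.setNat (by omega) (by omega) _ _, Q, m, hkm, by simpa using hm,
      hQ.setNat (by omega) _ _, hI.setNat (by omega) _ _, hiff⟩
  · rintro τ ⟨hB, Q, m, hkm, hm, hQ, hI, hiff⟩
    have hQ' : Queue T Q N τ := ⟨fun j hj => hQ.cell j (by omega),
      fun j hj => hQ.ne_zero j (by omega), fun i j hi hj => hQ.inj i j (by omega) (by omega),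
      fun j hj => hQ.order j (by omega)⟩
    refine ⟨hB, fun v hv => ?_, Q, hQ'⟩
    have hemp : remaining Q N = ∅ := by
      ext u
      simp only [Finset.notMem_empty, iff_false, mem_remaining, not_and, not_forall, not_not]
      intro hu
      obtain ⟨j, hj, hju⟩ := hQ'.exists_eq hu
      exact ⟨j, hj, hju⟩
    rw [hI.edges v, hemp]; simp

end Peel

/-! ### Computing the clusters and their centres -/

/-- The expression for the distance between the vertices `e` and `f`. -/
def distExpr (e f : NatExpr) : RealExpr := .metric (.cell 1 e) (.cell 1 f)

/-- The current vertex of a loop over all vertices except the root. -/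
def loopVertex : NatExpr := .add (natVar 11) (.const 1)

/-- Initialize the loads (array `2`) and the scores (array `3`) with the contributions of the
vertices themselves. -/
def initScores : Program :=
  .seq (.setReal 2 (.const 0) (.const 0))
  (.seq (.setReal 3 (.const 0) (.const 0))
  (forLoop
    (.seq (.setReal 2 loopVertex (realCell 0 11))
    (.setReal 3 loopVertex (.sub (.const 0)
      (.div (.mul (realCell 0 11) (distExpr (.const 0) loopVertex)) (.cell 1 (.const 0))))))))

/-- The score of the current vertex including the edge to its parent. -/
def edgeScoreExpr : RealExpr :=
  .add (realCell 3 13) (.mul (.sub (.mul (.const 2) (realCell 2 13))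
    (.div (.cell 1 (.const 0)) (.const 2))) (distExpr (natVar 13) (natVar 15)))

/-- From the leaves to the root, decide for every vertex whether the edge above it is removed (flag
`1` in the array `7`) or kept; in the latter case add its load and its score to its parent. -/
def chooseCuts : Program :=
  forLoop
    (.seq (loadVertex (natCell 6 11))
    (.ite (.realLt (.const 0) edgeScoreExpr)
      (.setNat 7 (natVar 13) (.const 1))
      (.seq (.setNat 7 (natVar 13) (.const 0))
      (.seq (.setReal 3 (natVar 15) (.add (realCell 3 15) edgeScoreExpr))
      (.setReal 2 (natVar 15) (.add (realCell 2 15) (realCell 2 13)))))))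

/-- The cost of choosing the current vertex as the centre of its cluster, up to a constant that
depends on the cluster only. -/
def centreExpr : RealExpr :=
  .add (.mul (.add (.const 1) (.cell 2 (natCell 8 13))) (distExpr (.const 0) (natVar 13)))
    (realCell 4 13)

/-- From the root to the leaves, compute the top of the cluster (array `8`) and the change of the
sum of distances (array `4`) of every vertex, and for every cluster the best centre so far (array
`9`) and its cost (array `5`). -/
def chooseCentres : Program :=
  .seq (.setNat 8 (.const 0) (.const 0))
  (.seq (.setReal 4 (.const 0) (.const 0))
  (forLoop
    (.seq (loadVertex (.cell 6 (.sub (.sub (natVar 10) (.const 1)) (natVar 11))))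
    (.ite (.natEq (natCell 7 13) (.const 1))
      (.seq (.setNat 8 (natVar 13) (natVar 13))
      (.seq (.setReal 4 (natVar 13) (.const 0))
      (.seq (.setNat 9 (natVar 13) (natVar 13))
      (.setReal 5 (natVar 13) centreExpr))))
      (.seq (.setNat 8 (natVar 13) (natCell 8 15))
      (.seq (.setReal 4 (natVar 13) (.add (realCell 4 15)
        (.mul (.sub (.cell 2 (natCell 8 13)) (.mul (.const 2) (realCell 2 13)))
          (distExpr (natVar 13) (natVar 15)))))
      (.ite (.realLt centreExpr (.cell 5 (natCell 8 13)))
        (.seq (.setReal 5 (natCell 8 13) centreExpr)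
        (.setNat 9 (natCell 8 13) (natVar 13)))
        .skip)))))))

/-- Replace the edge above the top of every cluster by an edge from the root to the centre. -/
def replaceEdges : Program :=
  forLoop
    (.ite (.natEq (.cell 7 loopVertex) (.const 1))
      (.seq (.setNat 2 (.cell 5 loopVertex) (.const 0))
      (.setNat 3 (.cell 5 loopVertex) (.cell 9 loopVertex)))
      .skip)

section Cluster

variable {M : Type*} {N : ℕ} {l r : Fin N → Fin (N + 1)}

/-- The memory after the peeling: the edge above every vertex is in the array `5`, and the queue
lists all vertices but the root. -/
structure Ready (T : Orientation l r) (s : ℕ) (pos : Fin (N + 1) → M) (w : Fin (N + 1) → ℝ)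
    (μ : ℝ) (Q : ℕ → Fin (N + 1)) (σ : Memory M) : Prop where
  base : Base T s pos w μ σ
  edge : ∀ v : Fin (N + 1), v ≠ 0 → σ.nat 5 v = T.edge v
  queue : Queue T Q N σ

variable {T : Orientation l r} {s : ℕ} {pos : Fin (N + 1) → M} {w : Fin (N + 1) → ℝ} {μ : ℝ}
  {Q : ℕ → Fin (N + 1)}

theorem Ready.setNat {σ : Memory M} (h : Ready T s pos w μ Q σ) {a : ℕ} (ha : 7 ≤ a) (ha' : a ≠ 10)
    (i x : ℕ) : Ready T s pos w μ Q (σ.setNat a i x) where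
  base := h.base.setNat (by omega) ha' i x
  edge := by simpa [show 5 ≠ a by omega] using h.edge
  queue := h.queue.setNat (by omega) i x

theorem Ready.setReal {σ : Memory M} (h : Ready T s pos w μ Q σ) {a : ℕ} (ha : 2 ≤ a)
    (i : ℕ) (x : ℝ) : Ready T s pos w μ Q (σ.setReal a i x) where
  base := h.base.setReal ha i x
  edge := by simpa using h.edge
  queue := h.queue.setReal i x

/-- The root, and the vertices of the queue from position `k` on: what a loop that reads the queue
from its end has processed when `k` vertices are left. -/
def Visited (Q : ℕ → Fin (N + 1)) (k : ℕ) (v : Fin (N + 1)) : Prop :=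
  v = 0 ∨ ∃ j, k ≤ j ∧ j < N ∧ Q j = v

/-- In the order of the queue a parent comes after its children. -/
theorem Visited.parent {σ : Memory M} (hQ : Queue T Q N σ) {k : ℕ} {v : Fin (N + 1)}
    (h : Visited Q k v) : Visited Q k (T.parent v) := by
  rcases h with rfl | ⟨j, hkj, hj, rfl⟩
  · exact Or.inl T.parent_zero
  · by_cases hp : T.parent (Q j) = 0
    · exact Or.inl hp
    · obtain ⟨i, hi, hip⟩ := hQ.exists_eq hp
      obtain ⟨i', hi', hij⟩ := hQ.order i hi (Q j) (hQ.ne_zero j hj) hip.symm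
      have := hQ.inj i' j (by omega) hj hij
      exact Or.inr ⟨i, by omega, hi, hip⟩

theorem visited_iff {k : ℕ} (hk : k < N) (v : Fin (N + 1)) :
    Visited Q k v ↔ Visited Q (k + 1) v ∨ v = Q k := by
  constructor
  · rintro (h | ⟨j, hkj, hj, h⟩)
    · exact Or.inl (Or.inl h)
    · rcases hkj.eq_or_lt with rfl | hkj
      · exact Or.inr h.symm
      · exact Or.inl (Or.inr ⟨j, hkj, hj, h⟩)
  · rintro ((h | ⟨j, hkj, hj, h⟩) | h)
    · exact Or.inl h
    · exact Or.inr ⟨j, by omega, hj, h⟩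
    · exact Or.inr ⟨k, le_rfl, hk, h.symm⟩

variable [PseudoMetricSpace M] {I : Problem M} {β : ℝ} {R : SubroutineRun I β}

theorem runs_initScores {σ : Memory M} (h : Ready T s pos w μ Q σ) (hw0 : w 0 = 0) :
    Runs R initScores σ (4 * N + 4) fun τ => Ready T s pos w μ Q τ ∧
      (∀ v : Fin (N + 1), τ.real 2 v = w v) ∧
      ∀ v : Fin (N + 1), τ.real 3 v = -(w v * dist (pos 0) (pos v) / μ) := by
  refine (Runs.seq (k := 1) (l := 1 + (4 * N + 2)) (Runs.setReal (Runs.seq (Runs.setReal ?_)))).mono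
    (by omega) fun _ h => h
  refine (Runs.forLoop (n := N) (c := 2) (Inv := fun k τ => Ready T s pos w μ Q τ ∧
    (∀ v : Fin (N + 1), (v : ℕ) ≤ k → τ.real 2 v = w v) ∧
    ∀ v : Fin (N + 1), (v : ℕ) ≤ k → τ.real 3 v = -(w v * dist (pos 0) (pos v) / μ))
    (fun k τ hI => hI.1.base.size) ?_ ?_).mono le_rfl ?_
  · rintro k τ hk ⟨hR, hX, hG⟩ hi
    let u : Fin (N + 1) := ⟨k + 1, by omega⟩
    have hu : u ≠ 0 := fun h => by have := congrArg Fin.val h; simp [u] at this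
    have hwu : τ.real 0 k = w u := by simpa [u] using hR.base.weight u hu
    have hpu : τ.point 1 (k + 1) = pos u := hR.base.point u
    have hp0 : τ.point 1 0 = pos 0 := hR.base.point 0
    have hle : ∀ x : Fin (N + 1), (x : ℕ) ≤ k + 1 → (x : ℕ) ≤ k ∨ x = u := by
      intro x hx
      rw [Fin.ext_iff]
      simp only [u]; omega
    refine Runs.seq (k := 1) (l := 1) (Runs.setReal (Runs.setReal ?_))
    refine ⟨by simpa using hi, ?_, fun v hv => ?_, fun v hv => ?_⟩
    · exact ((hR.setReal (by omega) _ _).setReal (by omega) _ _).setNat (by omega) (by omega) _ _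
    · rcases hle v hv with h1 | rfl
      · have : (v : ℕ) ≠ k + 1 := by omega
        simpa [loopVertex, natVar, NatExpr.eval, hi, this] using hX v h1
      · simp [loopVertex, natVar, NatExpr.eval, RealExpr.eval, realCell, hi, u, hwu]
    · rcases hle v hv with h1 | rfl
      · have : (v : ℕ) ≠ k + 1 := by omega
        simpa [loopVertex, natVar, NatExpr.eval, hi, this] using hG v h1
      · simp [loopVertex, natVar, NatExpr.eval, RealExpr.eval, PointExpr.eval, realCell, distExpr,
          hi, hwu, hpu, hp0, hR.base.threshold, u]
  · refine ⟨?_, fun v hv => ?_, fun v hv => ?_⟩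
    · exact ((h.setReal (by omega) _ _).setReal (by omega) _ _).setNat (by omega) (by omega) _ _
    · have : v = 0 := Fin.ext (by simpa using hv)
      subst this
      simp [NatExpr.eval, RealExpr.eval, hw0]
    · have : v = 0 := Fin.ext (by simpa using hv)
      subst this
      simp [NatExpr.eval, RealExpr.eval, hw0]
  · rintro τ ⟨hR, hX, hG⟩
    exact ⟨hR, fun v => hX v v.is_le, fun v => hG v v.is_le⟩

/-- The clustering of the tree with the geometry given by `pos`. -/
abbrev TreeClustering (T : Orientation l r) (pos : Fin (N + 1) → M) (w : Fin (N + 1) → ℝ)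
    (μ : ℝ) : Type :=
  Clustering T.toRootedTree (fun v => dist (pos v) (pos (T.parent v)))
    (fun v => dist (pos 0) (pos v)) w μ

/-- The memory after the cuts have been chosen: the loads are in the array `2` of real numbers, and
the array `7` of natural numbers marks the tops of the clusters. -/
structure Scored (Z : TreeClustering T pos w μ) (s : ℕ) (Q : ℕ → Fin (N + 1)) (σ : Memory M) :
    Prop where
  ready : Ready T s pos w μ Q σ
  load : ∀ v : Fin (N + 1), σ.real 2 v = Z.load v
  flag : ∀ v : Fin (N + 1), v ≠ 0 → (σ.nat 7 v = 1 ↔ 0 < Z.edgeScore v)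

variable {Z : TreeClustering T pos w μ}

theorem Scored.setNat {σ : Memory M} (h : Scored Z s Q σ) {a : ℕ} (ha : 8 ≤ a) (ha' : a ≠ 10)
    (i x : ℕ) : Scored Z s Q (σ.setNat a i x) where
  ready := h.ready.setNat (by omega) ha' i x
  load := by simpa using h.load
  flag := by simpa [show 7 ≠ a by omega] using h.flag

theorem Scored.setReal {σ : Memory M} (h : Scored Z s Q σ) {a : ℕ} (ha : 4 ≤ a)
    (i : ℕ) (x : ℝ) : Scored Z s Q (σ.setReal a i x) where
  ready := h.ready.setReal (by omega) i x
  load := by simpa [show 2 ≠ a by omega] using h.load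
  flag := by simpa using h.flag

theorem runs_chooseCuts {σ : Memory M} (h : Ready T s pos w μ Q σ)
    (h2 : ∀ v : Fin (N + 1), σ.real 2 v = w v)
    (h3 : ∀ v : Fin (N + 1), σ.real 3 v = -(w v * dist (pos 0) (pos v) / μ)) :
    Runs R chooseCuts σ (9 * N + 2) (Scored Z s Q) := by
  refine (Runs.forLoop (n := N) (c := 7) (Inv := fun k τ => Ready T s pos w μ Q τ ∧
    (∀ v : Fin (N + 1), τ.real 2 v = w v + ∑ j ∈ Finset.range k,
      if T.parent (Q j) = v then (if 0 < Z.edgeScore (Q j) then 0 else Z.load (Q j)) else 0) ∧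
    (∀ v : Fin (N + 1), τ.real 3 v = -(w v * dist (pos 0) (pos v) / μ) + ∑ j ∈ Finset.range k,
      if T.parent (Q j) = v then (if 0 < Z.edgeScore (Q j) then 0 else Z.edgeScore (Q j)) else 0) ∧
    ∀ j, j < k → (τ.nat 7 (Q j) = 1 ↔ 0 < Z.edgeScore (Q j)))
    (fun k τ hI => hI.1.base.size) ?_ ?_).mono (by omega) ?_
  · rintro k τ hk ⟨hR, hX, hG, hF⟩ hi
    set v := Q k with hv
    have hv0 : v ≠ 0 := hR.queue.ne_zero k hk
    set u := T.parent v with hu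
    -- All children of `v` have been processed, so its load and its score are final.
    have hXv : τ.real 2 v = Z.load v := by
      rw [hX v, Z.load_eq v, hR.queue.sum_children_lt
        (fun u => if 0 < Z.score u + (2 * Z.load u - μ / 2) * dist (pos u) (pos (T.parent u))
          then 0 else Z.load u) hk]
      rfl
    have hGv : τ.real 3 v = Z.score v := by
      rw [hG v, Z.score_eq v, hR.queue.sum_children_lt
        (fun u => if 0 < Z.score u + (2 * Z.load u - μ / 2) * dist (pos u) (pos (T.parent u))
          then 0 else Z.score u + (2 * Z.load u - μ / 2) * dist (pos u) (pos (T.parent u))) hk]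
      rfl
    have hpv : τ.point 1 v = pos v := hR.base.point v
    have hpu : τ.point 1 u = pos u := hR.base.point u
    have hthr := hR.base.threshold
    have hqne : ∀ j, j < k → (Q j : ℕ) ≠ v := fun j hj h => by
      have := hR.queue.inj j k (by omega) hk (Fin.ext h)
      omega
    refine Runs.seq (k := 3) (l := 4) (runs_loadVertex hR.base hv0 (v := v) ?_ (hR.edge v hv0) ?_)
    · simp only [natCell, natVar, NatExpr.eval, hi, hR.queue.cell k hk, ← hv]
    set ρ := ((τ.setNat 13 0 v).setNat 14 0 (T.edge v)).setNat 15 0 u with hρ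
    have hRρ : Ready T s pos w μ Q ρ := ((hR.setNat (by omega) (by omega) _ _).setNat (by omega)
      (by omega) _ _).setNat (by omega) (by omega) _ _
    have hes : Z.edgeScore v = Z.score v + (2 * Z.load v - μ / 2) * dist (pos v) (pos u) := rfl
    have hev : ∀ x y, edgeScoreExpr.eval (ρ.setNat 7 x y) = Z.edgeScore v := by
      intro x y
      simp [edgeScoreExpr, RealExpr.eval, realCell, natVar, NatExpr.eval, distExpr,
        PointExpr.eval, hρ, hGv, hXv, hpv, hpu, hthr, hes]
    have hev' : edgeScoreExpr.eval ρ = Z.edgeScore v := by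
      simp [edgeScoreExpr, RealExpr.eval, realCell, natVar, NatExpr.eval, distExpr,
        PointExpr.eval, hρ, hGv, hXv, hpv, hpu, hthr, hes]
    have h13 : ∀ x y, (ρ.setNat 7 x y).nat 13 0 = v := by simp [hρ]
    have h15 : ∀ x y, (ρ.setNat 7 x y).nat 15 0 = u := by simp [hρ]
    have h13' : ρ.nat 13 0 = v := by simp [hρ]
    have h11 : ρ.nat 11 0 = k := by simp [hρ, hi]
    have h7 : ∀ x, ρ.nat 7 x = τ.nat 7 x := by simp [hρ]
    have hreal : ρ.real = τ.real := by simp [hρ]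
    clear_value ρ
    refine Runs.ite (k := 3) (fun ht => ?_) fun hf => ?_
    · have hcut : 0 < Z.edgeScore v := by
        simpa [Test.Holds, hev', RealExpr.eval] using ht
      refine (Runs.setNat ?_).mono (by omega) fun _ h => h
      simp only [natVar, NatExpr.eval, h13']
      refine ⟨by simpa using h11, ?_, fun x => ?_, fun x => ?_, fun j hj => ?_⟩
      · exact (hRρ.setNat (by omega) (by omega) _ _).setNat (by omega) (by omega) _ _
      · rw [Finset.sum_range_succ, ← hv, if_pos hcut, ite_self, add_zero, ← hX x]
        simp [hreal]
      · rw [Finset.sum_range_succ, ← hv, if_pos hcut, ite_self, add_zero, ← hG x]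
        simp [hreal]
      · rcases Nat.lt_succ_iff_lt_or_eq.1 hj with hj | rfl
        · simpa [hqne j hj, h7] using hF j hj
        · simpa [← hv] using hcut
    · have hcut : ¬ 0 < Z.edgeScore v := by
        simpa [Test.Holds, hev', RealExpr.eval] using hf
      refine Runs.seq (k := 1) (l := 2) (Runs.setNat (Runs.seq (k := 1) (l := 1)
        (Runs.setReal (Runs.setReal ?_))))
      simp only [natVar, realCell, NatExpr.eval, RealExpr.eval, h13', hev, h13, h15,
        Memory.nat_setReal]
      refine ⟨by simpa using h11, ?_, fun x => ?_, fun x => ?_, fun j hj => ?_⟩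
      · exact (((hRρ.setNat (by omega) (by omega) _ _).setReal (by omega) _ _).setReal
          (by omega) _ _).setNat (by omega) (by omega) _ _
      · rw [Finset.sum_range_succ, ← hv, if_neg hcut, ← add_assoc, ← hX x, ← hu]
        by_cases hx : u = x
        · subst hx; simp [hreal, hXv]
        · have : ¬ (x : ℕ) = u := fun h => hx (Fin.ext h.symm)
          simp [hreal, hx, this]
      · rw [Finset.sum_range_succ, ← hv, if_neg hcut, ← add_assoc, ← hG x, ← hu]
        by_cases hx : u = x
        · subst hx; simp [hreal]
        · have : ¬ (x : ℕ) = u := fun h => hx (Fin.ext h.symm)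
          simp [hreal, hx, this]
      · rcases Nat.lt_succ_iff_lt_or_eq.1 hj with hj | rfl
        · simpa [hqne j hj, h7] using hF j hj
        · simpa [← hv] using hcut
  · exact ⟨h.setNat (by omega) (by omega) _ _, by simpa using h2, by simpa using h3,
      fun j hj => absurd hj (by omega)⟩
  · rintro τ ⟨hR, hX, hG, hF⟩
    refine ⟨hR, fun v => ?_, fun v hv => ?_⟩
    · rw [hX v, Z.load_eq v, hR.queue.sum_children
        (fun u => if 0 < Z.score u + (2 * Z.load u - μ / 2) * dist (pos u) (pos (T.parent u))
          then 0 else Z.load u)]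
      rfl
    · obtain ⟨j, hj, rfl⟩ := hR.queue.exists_eq hv
      exact hF j hj

/-- The cost of the centre `v`, up to a constant that depends on the cluster only. -/
noncomputable def centreCost (Z : TreeClustering T pos w μ) (v : Fin (N + 1)) : ℝ :=
  (1 + Z.load (Z.top v)) * dist (pos 0) (pos v) + Z.reroot v

/-- The state of `chooseCentres` when the vertices in `D` have been processed. -/
structure Centred (Z : TreeClustering T pos w μ) (D : Fin (N + 1) → Prop) (σ : Memory M) :
    Prop where
  top : ∀ v, D v → σ.nat 8 v = Z.top v
  reroot : ∀ v, D v → σ.real 4 v = Z.reroot v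
  best : ∀ v, D v → v ≠ 0 → 0 < Z.edgeScore v → ∃ b : Fin (N + 1), σ.nat 9 v = b ∧ Z.top b = v ∧
    σ.real 5 v = centreCost Z b ∧ ∀ x, D x → Z.top x = v → centreCost Z b ≤ centreCost Z x

/-- A new cluster starts with its top as the only candidate for the centre. -/
theorem Centred.insert_cut {D : Fin (N + 1) → Prop} {σ τ : Memory M} (h : Centred Z D σ)
    {v : Fin (N + 1)} (hv : ¬ D v) (hk : ¬ Z.Kept v) (hclosed : ∀ x, D x → Z.top x ≠ v)
    (h8 : ∀ x : Fin (N + 1), τ.nat 8 x = if x = v then (Z.top v : ℕ) else σ.nat 8 x)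
    (h4 : ∀ x : Fin (N + 1), τ.real 4 x = if x = v then Z.reroot v else σ.real 4 x)
    (h9 : ∀ x : Fin (N + 1), τ.nat 9 x = if x = v then (v : ℕ) else σ.nat 9 x)
    (h5 : ∀ x : Fin (N + 1), τ.real 5 x = if x = v then centreCost Z v else σ.real 5 x) :
    Centred Z (fun x => D x ∨ x = v) τ := by
  refine ⟨?_, ?_, ?_⟩
  · rintro x (hx | rfl)
    · rw [h8, if_neg (fun e : x = v => hv (e ▸ hx)), h.top x hx]
    · rw [h8, if_pos rfl]
  · rintro x (hx | rfl)
    · rw [h4, if_neg (fun e : x = v => hv (e ▸ hx)), h.reroot x hx]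
    · rw [h4, if_pos rfl]
  · rintro x (hx | rfl) hx0 hxc
    · have hxv : x ≠ v := fun h => hv (h ▸ hx)
      obtain ⟨b, h1, h2, h3, h6⟩ := h.best x hx hx0 hxc
      refine ⟨b, by rw [h9, if_neg hxv, h1], h2, by rw [h5, if_neg hxv, h3], ?_⟩
      rintro y (hy | rfl) hyx
      · exact h6 y hy hyx
      · rw [Z.top_of_not_kept hk] at hyx
        exact absurd hyx.symm hxv
    · refine ⟨x, by rw [h9, if_pos rfl], Z.top_of_not_kept hk, by rw [h5, if_pos rfl], ?_⟩
      rintro y (hy | rfl) hyx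
      · exact absurd hyx (hclosed y hy)
      · exact le_rfl

/-- A vertex that joins a cluster is compared with the best centre so far.  The cluster of the root
needs no centre, so what is written for it is irrelevant. -/
theorem Centred.insert_kept {D : Fin (N + 1) → Prop} {σ τ : Memory M} (h : Centred Z D σ)
    {v : Fin (N + 1)} (hv : ¬ D v) (hk : Z.Kept v)
    (h8 : ∀ x : Fin (N + 1), τ.nat 8 x = if x = v then (Z.top v : ℕ) else σ.nat 8 x)
    (h4 : ∀ x : Fin (N + 1), τ.real 4 x = if x = v then Z.reroot v else σ.real 4 x)
    (h95 : (centreCost Z v < σ.real 5 (Z.top v) ∧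
        (∀ x : Fin (N + 1), τ.nat 9 x = if x = Z.top v then (v : ℕ) else σ.nat 9 x) ∧
        ∀ x : Fin (N + 1), τ.real 5 x = if x = Z.top v then centreCost Z v else σ.real 5 x) ∨
      (¬ centreCost Z v < σ.real 5 (Z.top v) ∧ (∀ x : Fin (N + 1), τ.nat 9 x = σ.nat 9 x) ∧
        ∀ x : Fin (N + 1), τ.real 5 x = σ.real 5 x)) :
    Centred Z (fun x => D x ∨ x = v) τ := by
  refine ⟨?_, ?_, ?_⟩
  · rintro x (hx | rfl)
    · rw [h8, if_neg (fun e : x = v => hv (e ▸ hx)), h.top x hx]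
    · rw [h8, if_pos rfl]
  · rintro x (hx | rfl)
    · rw [h4, if_neg (fun e : x = v => hv (e ▸ hx)), h.reroot x hx]
    · rw [h4, if_pos rfl]
  · rintro x (hx | rfl) hx0 hxc
    · obtain ⟨b, h1, h2, h3, h6⟩ := h.best x hx hx0 hxc
      by_cases hxt : x = Z.top v
      · rcases h95 with ⟨hlt, h9, h5⟩ | ⟨hlt, h9, h5⟩
        · refine ⟨v, by rw [h9, if_pos hxt], hxt.symm, by rw [h5, if_pos hxt], ?_⟩
          rw [← hxt, h3] at hlt
          rintro y (hy | rfl) hyx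
          · exact hlt.le.trans (h6 y hy hyx)
          · exact le_rfl
        · refine ⟨b, by rw [h9, h1], h2, by rw [h5, h3], ?_⟩
          rw [← hxt, h3] at hlt
          rintro y (hy | rfl) hyx
          · exact h6 y hy hyx
          · exact not_lt.1 hlt
      · refine ⟨b, ?_, h2, ?_, ?_⟩
        · rcases h95 with ⟨_, h9, _⟩ | ⟨_, h9, _⟩
          · rw [h9, if_neg hxt, h1]
          · rw [h9, h1]
        · rcases h95 with ⟨_, _, h5⟩ | ⟨_, _, h5⟩
          · rw [h5, if_neg hxt, h3]
          · rw [h5, h3]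
        · rintro y (hy | rfl) hyx
          · exact h6 y hy hyx
          · exact absurd hyx.symm hxt
    · exact absurd hxc hk.2

theorem Visited.below {σ : Memory M} (hQ : Queue T Q N σ) {k : ℕ} {v f : Fin (N + 1)}
    (h : Visited Q k v) (hb : Z.Below v f) : Visited Q k f := by
  induction hb with
  | refl => exact h
  | tail _ hbc ih => rw [← hbc.2]; exact ih.parent hQ

theorem runs_chooseCentres {σ : Memory M} (h : Scored Z s Q σ) :
    Runs R chooseCentres σ (11 * N + 4) fun τ => Scored Z s Q τ ∧ Centred Z (fun _ => True) τ := by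
  refine (Runs.seq (k := 1) (l := 1 + (11 * N + 2)) (Runs.setNat (Runs.seq (Runs.setReal ?_)))).mono
    (by omega) fun _ h => h
  refine (Runs.forLoop (n := N) (c := 9) (Inv := fun k τ => Scored Z s Q τ ∧
    Centred Z (Visited Q (N - k)) τ)
    (fun k τ hI => hI.1.ready.base.size) ?_ ?_).mono le_rfl ?_
  · rintro k τ hk ⟨hS, hC⟩ hi
    have hR := hS.ready
    have hQ := hR.queue
    obtain ⟨i, hiN, hi1, hi2, hi3⟩ : ∃ i, i < N ∧ N - k = i + 1 ∧ N - (k + 1) = i ∧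
      N - 1 - k = i := ⟨N - 1 - k, by omega, by omega, by omega, rfl⟩
    rw [hi1] at hC
    have hvis : Visited Q (N - (k + 1)) = fun x => Visited Q (i + 1) x ∨ x = Q i := by
      rw [hi2]
      funext x
      exact propext (visited_iff hiN x)
    rw [hvis]
    set v := Q i with hv
    have hv0 : v ≠ 0 := hQ.ne_zero i hiN
    have hvD : ¬ Visited Q (i + 1) v := by
      rintro (h | ⟨j, hij, hj, h⟩)
      · exact hv0 h
      · have := hQ.inj j i hj hiN h
        omega
    set u := T.parent v with hu
    have huD : Visited Q (i + 1) u := by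
      have h1 : Visited Q i u := Visited.parent hQ ((visited_iff hiN v).2 (Or.inr rfl))
      exact ((visited_iff hiN u).1 h1).resolve_right (T.parent_ne hv0)
    have hpv : τ.point 1 v = pos v := hR.base.point v
    have hpu : τ.point 1 u = pos u := hR.base.point u
    have hp0 : τ.point 1 0 = pos 0 := hR.base.point 0
    have h8u := hC.top u huD
    have h4u := hC.reroot u huD
    have hflag := hS.flag v hv0
    refine Runs.seq (k := 3) (l := 6) (runs_loadVertex hR.base hv0 (v := v) ?_ (hR.edge v hv0) ?_)
    · simp only [natVar, NatExpr.eval, hi, hR.base.size, hi3, hQ.cell i hiN, ← hv]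
    set ρ := ((τ.setNat 13 0 v).setNat 14 0 (T.edge v)).setNat 15 0 u with hρ
    have hSρ : Scored Z s Q ρ := ((hS.setNat (by omega) (by omega) _ _).setNat (by omega)
      (by omega) _ _).setNat (by omega) (by omega) _ _
    have h13 : ρ.nat 13 0 = v := by simp [hρ]
    have h15 : ρ.nat 15 0 = u := by simp [hρ]
    have h11 : ρ.nat 11 0 = k := by simp [hρ, hi]
    have h7 : ∀ x, ρ.nat 7 x = τ.nat 7 x := by simp [hρ]
    have h8 : ∀ x, ρ.nat 8 x = τ.nat 8 x := by simp [hρ]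
    have h9 : ∀ x, ρ.nat 9 x = τ.nat 9 x := by simp [hρ]
    have hreal : ρ.real = τ.real := by simp [hρ]
    have hpoint : ρ.point = τ.point := by simp [hρ]
    clear_value ρ
    refine Runs.ite (k := 5) (fun ht => ?_) fun hf => ?_
    · have hcut : 0 < Z.edgeScore v := by
        simpa [Test.Holds, natCell, natVar, NatExpr.eval, h13, h7, hflag] using ht
      have hk' : ¬ Z.Kept v := fun h => h.2 hcut
      have htop : Z.top v = v := Z.top_of_not_kept hk'
      have hre : Z.reroot v = 0 := by rw [Z.reroot_eq v hv0]; exact if_pos hcut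
      have hval : centreExpr.eval ((((ρ.setNat 8 v v).setReal 4 v 0).setNat 9 v v)) =
          centreCost Z v := by
        simp [centreExpr, RealExpr.eval, PointExpr.eval, NatExpr.eval, natCell, natVar, realCell,
          distExpr, h13, hreal, hpoint, hpv, hp0, centreCost, htop, hre, hS.load v]
      refine (Runs.seq (k := 1) (l := 3) (Runs.setNat (Runs.seq (k := 1) (l := 2)
        (Runs.setReal (Runs.seq (k := 1) (l := 1) (Runs.setNat (Runs.setReal ?_))))))).mono
        (by omega) fun _ h => h
      simp only [natVar, NatExpr.eval, RealExpr.eval, h13, Memory.nat_setNat, Memory.nat_setReal,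
        Nat.reduceEqDiff, false_and, if_false, Rat.cast_zero, hval]
      refine ⟨h11, ?_, hC.insert_cut hvD hk' (fun x hx hxv => hvD ?_) (fun x => ?_) (fun x => ?_)
        (fun x => ?_) fun x => ?_⟩
      · exact ((((hSρ.setNat (by omega) (by omega) _ _).setReal (by omega) _ _).setNat
          (by omega) (by omega) _ _).setReal (by omega) _ _).setNat (by omega) (by omega) _ _
      · exact hxv ▸ hx.below hQ (Z.below_top x)
      · simp [Fin.val_inj, h8, htop]
      · simp [Fin.val_inj, hreal, hre]
      · simp [Fin.val_inj, h9]
      · simp [Fin.val_inj, hreal]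
    · have hcut : ¬ 0 < Z.edgeScore v := by
        simpa [Test.Holds, natCell, natVar, NatExpr.eval, h13, h7, hflag] using hf
      have hk' : Z.Kept v := ⟨hv0, hcut⟩
      have htop : Z.top u = Z.top v := (Z.top_of_kept hk').symm
      have hre : Z.reroot v = Z.reroot u +
          (Z.load (Z.top v) - 2 * Z.load v) * dist (pos v) (pos u) := by
        rw [Z.reroot_eq v hv0]; exact if_neg hcut
      rw [htop] at h8u
      have hval4 : RealExpr.eval (ρ.setNat 8 v (Z.top v)) (.add (realCell 4 15)
          (.mul (.sub (.cell 2 (natCell 8 13)) (.mul (.const 2) (realCell 2 13)))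
          (distExpr (natVar 13) (natVar 15)))) = Z.reroot v := by
        simp [RealExpr.eval, PointExpr.eval, NatExpr.eval, natCell, natVar, realCell,
          distExpr, h13, h15, hreal, hpoint, hpv, hpu, hS.load, h4u, hre]
      have hval : centreExpr.eval ((ρ.setNat 8 v (Z.top v)).setReal 4 v (Z.reroot v)) =
          centreCost Z v := by
        simp [centreExpr, RealExpr.eval, PointExpr.eval, NatExpr.eval, natCell, natVar, realCell,
          distExpr, h13, hreal, hpoint, hpv, hp0, centreCost, hS.load]
      refine Runs.seq (k := 1) (l := 4) (Runs.setNat (Runs.seq (k := 1) (l := 3)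
        (Runs.setReal ?_)))
      rw [show NatExpr.eval ρ (natVar 13) = v by simp [natVar, NatExpr.eval, h13],
        show NatExpr.eval ρ (natCell 8 15) = Z.top v by
          simp [natCell, natVar, NatExpr.eval, h15, h8, h8u],
        show NatExpr.eval (ρ.setNat 8 v (Z.top v)) (natVar 13) = v by
          simp [natVar, NatExpr.eval, h13], hval4]
      refine Runs.ite (k := 2) (fun ht => ?_) fun hf => ?_
      · have hlt : centreCost Z v < τ.real 5 (Z.top v) := by
          simpa [Test.Holds, hval, RealExpr.eval, natCell, natVar, NatExpr.eval, h13, hreal] using ht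
        refine Runs.seq (k := 1) (l := 1) (Runs.setReal (Runs.setNat ?_))
        rw [hval]
        refine ⟨by simp [h11], ?_, hC.insert_kept hvD hk' (fun x => ?_) (fun x => ?_)
          (Or.inl ⟨hlt, fun x => ?_, fun x => ?_⟩)⟩
        · exact ((((hSρ.setNat (by omega) (by omega) _ _).setReal (by omega) _ _).setReal
            (by omega) _ _).setNat (by omega) (by omega) _ _).setNat (by omega) (by omega) _ _
        · simp [Fin.val_inj, h8]
        · simp [Fin.val_inj, hreal]
        · simp [Fin.val_inj, h9, natCell, natVar, NatExpr.eval, h13]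
        · simp [Fin.val_inj, hreal, natCell, natVar, NatExpr.eval, h13]
      · have hlt : ¬ centreCost Z v < τ.real 5 (Z.top v) := by
          simpa [Test.Holds, hval, RealExpr.eval, natCell, natVar, NatExpr.eval, h13, hreal] using hf
        refine (Runs.skip ?_).mono (by omega) fun _ h => h
        refine ⟨by simp [h11], ?_, hC.insert_kept hvD hk' (fun x => ?_) (fun x => ?_)
          (Or.inr ⟨hlt, fun x => ?_, fun x => ?_⟩)⟩
        · exact ((hSρ.setNat (by omega) (by omega) _ _).setReal (by omega) _ _).setNat
            (by omega) (by omega) _ _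
        · simp [Fin.val_inj, h8]
        · simp [Fin.val_inj, hreal]
        · simp [h9]
        · simp [hreal]
  · refine ⟨((h.setNat (by omega) (by omega) _ _).setReal (by omega) _ _).setNat
      (by omega) (by omega) _ _, ?_⟩
    have h0 : ∀ v, Visited Q (N - 0) v → v = 0 := by
      rintro v (h | ⟨j, hj, hj', _⟩)
      · exact h
      · omega
    refine ⟨fun v hv => ?_, fun v hv => ?_, fun v hv hv0 => absurd (h0 v hv) hv0⟩
    · rw [h0 v hv]
      simp [NatExpr.eval, Z.top_zero]
    · rw [h0 v hv]
      simp [NatExpr.eval, RealExpr.eval, Z.reroot_zero]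
  · rintro τ ⟨hS, hC⟩
    have hall : ∀ v, Visited Q (N - N) v := by
      intro v
      by_cases hv : v = 0
      · exact Or.inl hv
      · obtain ⟨j, hj, hjv⟩ := hS.ready.queue.exists_eq hv
        exact Or.inr ⟨j, by omega, hj, hjv⟩
    exact ⟨hS, fun v _ => hC.top v (hall v), fun v _ => hC.reroot v (hall v),
      fun v _ hv0 hcut => by
        obtain ⟨b, h1, h2, h3, h6⟩ := hC.best v (hall v) hv0 hcut
        exact ⟨b, h1, h2, h3, fun x _ => h6 x (hall x)⟩⟩

theorem runs_replaceEdges {σ : Memory M} (h : Scored Z s Q σ) {best : Fin (N + 1) → Fin (N + 1)}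
    (hb : ∀ v, v ≠ 0 → ¬ Z.Kept v → σ.nat 9 v = best v) :
    Runs R replaceEdges σ (5 * N + 2) fun τ => τ.nat 1 0 = s ∧
      (∀ i : Fin N, (Z.Kept (T.child i) → τ.nat 2 i = l i ∧ τ.nat 3 i = r i) ∧
        (¬ Z.Kept (T.child i) → τ.nat 2 i = 0 ∧ τ.nat 3 i = best (T.child i))) ∧
      ∀ v : Fin (N + 1), τ.point 1 v = pos v := by
  refine (Runs.forLoop (n := N) (c := 3) (Inv := fun k τ => τ.nat 10 0 = N ∧ τ.nat 1 0 = s ∧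
    τ.nat 5 = σ.nat 5 ∧ τ.nat 7 = σ.nat 7 ∧ τ.nat 9 = σ.nat 9 ∧ τ.point 1 = σ.point 1 ∧
    ∀ i : Fin N, (Z.Kept (T.child i) ∨ k < (T.child i : ℕ) → τ.nat 2 i = l i ∧ τ.nat 3 i = r i) ∧
      (¬ Z.Kept (T.child i) → (T.child i : ℕ) ≤ k → τ.nat 2 i = 0 ∧ τ.nat 3 i = best (T.child i)))
    (fun k τ hI => hI.1) ?_ ?_).mono (by omega) ?_
  · rintro k τ hk ⟨hN, hs, h5, h7, h9, hp, hE⟩ hi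
    let v : Fin (N + 1) := ⟨k + 1, by omega⟩
    have hv : v ≠ 0 := fun h => by have := congrArg Fin.val h; simp [v] at this
    have hedge : σ.nat 5 (k + 1) = T.edge v := h.ready.edge v hv
    have hflag : σ.nat 7 (k + 1) = 1 ↔ 0 < Z.edgeScore v := h.flag v hv
    have hiff : ∀ i : Fin N, (i : ℕ) = T.edge v ↔ T.child i = v := by
      intro i
      constructor
      · intro h; rw [h, T.child_edge v hv]
      · intro h; rw [← h, T.edge_child i i.2]
    have hval : ∀ i : Fin N, T.child i = v ↔ (T.child i : ℕ) = k + 1 := fun i => by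
      rw [Fin.ext_iff]
    refine Runs.ite (k := 2) (fun ht => ?_) fun hf => ?_
    · have hcut : 0 < Z.edgeScore v := by
        simpa [Test.Holds, loopVertex, natVar, NatExpr.eval, hi, h7, hflag] using ht
      have hk' : ¬ Z.Kept v := fun h => h.2 hcut
      have hbv : σ.nat 9 (k + 1) = best v := hb v hv hk'
      refine Runs.seq (k := 1) (l := 1) (Runs.setNat (Runs.setNat ?_))
      simp only [loopVertex, natVar, NatExpr.eval, Memory.nat_setNat]
      simp only [hi, h5, h9, hedge, hbv, Nat.reduceEqDiff, false_and, if_false]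
      refine ⟨by simp, by simp [hN], by simp [hs], ?_, ?_, ?_, by simp [hp], fun i => ?_⟩
      · funext x; simp [h5]
      · funext x; simp [h7]
      · funext x; simp [h9]
      · by_cases hiv : T.child i = v
        · have h1 := (hiff i).2 hiv
          have h2 := (hval i).1 hiv
          rw [hiv] at *
          simp [h1, hk', h2]
        · have h1 : ¬ (i : ℕ) = T.edge v := fun h => hiv ((hiff i).1 h)
          have h2 : ¬ (T.child i : ℕ) = k + 1 := fun h => hiv ((hval i).2 h)
          have h3 := hE i
          simp only [true_and, if_false, h1]
          exact ⟨fun h => h3.1 (h.imp id fun h => by omega), fun h h' => h3.2 h (by omega)⟩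
    · have hcut : ¬ 0 < Z.edgeScore v := by
        simpa [Test.Holds, loopVertex, natVar, NatExpr.eval, hi, h7, hflag] using hf
      have hk' : Z.Kept v := ⟨hv, hcut⟩
      refine (Runs.skip ?_).mono (by omega) fun _ h => h
      refine ⟨hi, by simp [hN], by simp [hs], ?_, ?_, ?_, by simp [hp], fun i => ?_⟩
      · funext x; simp [h5]
      · funext x; simp [h7]
      · funext x; simp [h9]
      · have h3 := hE i
        simp only [Memory.nat_setNat, Nat.reduceEqDiff, false_and, if_false]
        refine ⟨fun h => h3.1 (h.imp id fun h => by omega), fun h h' => h3.2 h ?_⟩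
        have : T.child i ≠ v := fun hiv => h (hiv ▸ hk')
        have h2 : ¬ (T.child i : ℕ) = k + 1 := fun h => this ((hval i).2 h)
        omega
  · have hB := h.ready.base
    refine ⟨by simp [hB.size], by simp [hB.steiner], ?_, ?_, ?_, rfl, fun i => ⟨fun _ => ?_,
      fun _ h0 => absurd (Fin.ext (by simpa using h0)) (T.child_ne i i.2)⟩⟩
    · funext x; simp
    · funext x; simp
    · funext x; simp
    · simp [hB.left i, hB.right i]
  · rintro τ ⟨-, hs, -, -, -, hp, hE⟩
    refine ⟨hs, fun i => ⟨fun h => (hE i).1 (Or.inl h), fun h => (hE i).2 h ?_⟩, fun v => ?_⟩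
    · exact (T.child i).is_le
    · rw [hp]; exact h.ready.base.point v

end Cluster

/-! ### The complete program -/

/-- The whole algorithm.  Apart from the cells fixed by the model, the arrays of natural numbers hold
degrees (`4`), sums of numbers of incident edges, which become the edges to the parents (`5`), the
queue (`6`), flags of removed edges (`7`), tops of clusters (`8`) and centres (`9`); the arrays of
real numbers hold loads (`2`), scores (`3`), changes of sums of distances (`4`) and costs of centres
(`5`).  Cell `0` of an array from `10` on is a scalar: the number of edges (`10`), the loop counter
(`11`), the length of the queue (`12`), and the current vertex (`13`) with its edge (`14`) and its
parent (`15`). -/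
def steinerProgram : Program :=
  .seq .steiner
  (.seq (.setNat 10 (.const 0) (.add (.cell 0 (.const 0)) (.cell 1 (.const 0))))
  (.seq countEdges
  (.seq collectLeaves
  (.seq peelLeaves
  (.seq initScores
  (.seq chooseCuts
  (.seq chooseCentres
  replaceEdges)))))))

section Main

variable {M : Type*} [PseudoMetricSpace M] {I : Problem M} {β : ℝ}

/-- The cells after the given weights are blank, in accordance with the weight zero of the Steiner
vertices. -/
theorem base_initial (R : SubroutineRun I β) (T : Orientation R.edges.left R.edges.right) (μ : ℝ) :
    Base T R.tree.numSteiner R.tree.pos R.tree.vertexWeight μ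
      (((Memory.initial I μ).store R.tree R.edges).setNat 10 0
        (I.numSinks + R.tree.numSteiner)) where
  size := by simp
  steiner := by simp [Memory.store]
  left i := by simp [Memory.store]
  right i := by simp [Memory.store]
  point v := dif_pos ⟨rfl, v.is_lt⟩
  weight v hv := by
    have h1 : (v : ℕ) ≠ 0 := fun h => hv (Fin.ext h)
    simp only [Memory.real_setNat, Memory.store, Memory.initial, SteinerTree.vertexWeight]
    by_cases h : (v : ℕ) ≤ I.numSinks
    · have h2 : (v : ℕ) - 1 < I.numSinks := by omega
      have h3 : 1 ≤ (v : ℕ) := by omega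
      simp [h, h2, h3]
    · have h2 : ¬ (v : ℕ) - 1 < I.numSinks := by omega
      simp [h, h2]
  threshold := by simp [Memory.store, Memory.initial]

theorem runs_steinerProgram (R : SubroutineRun I β) {μ : ℝ} (hμ : 0 < μ) :
    ∃ (A : SteinerTree I) (E : EdgeList A),
      Runs R steinerProgram (Memory.initial I μ) (51 * R.time) (fun τ => τ.Holds A E) ∧
      A.objective ≤ (1 + μ / 2) * R.tree.connectionCost + (1 + 1 / μ) * I.minDelay := by
  obtain ⟨T⟩ := Orientation.nonempty R.tree.isTree.connected R.edges.adj_iff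
  obtain ⟨Z⟩ := Clustering.nonempty T.toRootedTree (R.tree.parentDist T.toRootedTree)
    R.tree.rootDist R.tree.vertexWeight μ
  let Z' : TreeClustering T R.tree.pos R.tree.vertexWeight μ := Z
  have hw0 : R.tree.vertexWeight 0 = 0 := by simp [SteinerTree.vertexWeight]
  have hrun : Runs R steinerProgram (Memory.initial I μ)
      (50 * (I.numSinks + R.tree.numSteiner) + 20 + R.time) fun τ =>
      ∃ best : R.tree.Vertex → R.tree.Vertex, (∀ v, v ≠ 0 → ¬ Z'.Kept v → Z'.top (best v) = v ∧
        ∀ x, Z'.top x = v → centreCost Z' (best v) ≤ centreCost Z' x) ∧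
      τ.nat 1 0 = R.tree.numSteiner ∧
      (∀ i : Fin (I.numSinks + R.tree.numSteiner),
        (Z'.Kept (T.child i) → τ.nat 2 i = R.edges.left i ∧ τ.nat 3 i = R.edges.right i) ∧
        (¬ Z'.Kept (T.child i) → τ.nat 2 i = 0 ∧ τ.nat 3 i = best (T.child i))) ∧
      ∀ v : R.tree.Vertex, τ.point 1 v = R.tree.pos v := by
    set N := I.numSinks + R.tree.numSteiner with hN
    have hB := base_initial R T μ
    refine (Runs.seq (k := R.time) (l := 1 + ((6 * N + 2) + ((5 * N + 3) + ((10 * N + 2) +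
      ((4 * N + 4) + ((9 * N + 2) + ((11 * N + 4) + (5 * N + 2)))))))) (Runs.steiner (Runs.seq
      (Runs.setNat (Runs.seq ?_))))).mono (by omega) fun _ h => h
    have h10 : NatExpr.eval ((Memory.initial I μ).store R.tree R.edges)
        (.add (.cell 0 (.const 0)) (.cell 1 (.const 0))) = N := by
      simp [NatExpr.eval, Memory.store, Memory.initial, hN]
    rw [h10]
    refine (runs_countEdges hB (fun j => ?_) (fun j => ?_)).mono le_rfl ?_
    · simp [Memory.store, Memory.initial]
    · simp [Memory.store, Memory.initial]
    rintro τ ⟨hB, hI⟩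
    refine Runs.seq ((runs_collectLeaves hB hI).mono le_rfl fun τ hP => ?_)
    refine Runs.seq ((runs_peelLeaves hP).mono le_rfl ?_)
    rintro τ ⟨hB, he, Q, hQ⟩
    refine Runs.seq ((runs_initScores ⟨hB, he, hQ⟩ hw0).mono le_rfl ?_)
    rintro τ ⟨hR, h2, h3⟩
    refine Runs.seq ((runs_chooseCuts (Z := Z') hR h2 h3).mono le_rfl fun τ hS => ?_)
    refine Runs.seq ((runs_chooseCentres hS).mono le_rfl ?_)
    rintro τ ⟨hS, hC⟩
    have hbest : ∀ v, ∃ b : R.tree.Vertex, v ≠ 0 → ¬ Z'.Kept v → τ.nat 9 v = b ∧ Z'.top b = v ∧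
        ∀ x, Z'.top x = v → centreCost Z' b ≤ centreCost Z' x := by
      intro v
      by_cases h : v ≠ 0 ∧ 0 < Z'.edgeScore v
      · obtain ⟨b, h1, h2, -, h4⟩ := hC.best v trivial h.1 h.2
        exact ⟨b, fun _ _ => ⟨h1, h2, fun x => h4 x trivial⟩⟩
      · refine ⟨0, fun hv hk => absurd ⟨hv, ?_⟩ h⟩
        by_contra hn
        exact hk ⟨hv, hn⟩
    choose best hbest using hbest
    refine (runs_replaceEdges hS fun v hv hk => (hbest v hv hk).1).mono le_rfl fun τ hτ => ?_
    exact ⟨best, fun v hv hk => (hbest v hv hk).2, hτ⟩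
  obtain ⟨j, τ, hj, he, best, hbest, h1, h2, h3⟩ := hrun
  obtain ⟨A, E, hholds, hobj⟩ := exists_reconnected R.edges T hμ Z (best := best) fun v hv hk => by
    obtain ⟨htop, hmin⟩ := hbest v hv hk
    refine ⟨htop, fun x hx => ?_⟩
    have := hmin x hx
    rw [centreCost, centreCost, htop, hx] at this
    exact this
  have htime := R.card_le_time
  exact ⟨A, E, ⟨j, τ, by omega, he, hholds τ h1 h2 h3⟩, hobj⟩

end Main

end CostDistance

theorem mainTheorem1 :
    ∃ (P : CostDistance.Program) (K : ℕ),
      ∀ (M : Type*) [PseudoMetricSpace M] (I : CostDistance.Problem M) (μ : ℝ), 0 < μ →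
      ∀ (β : ℝ) (R : CostDistance.SubroutineRun I β),
        ∃ (k : ℕ) (τ : CostDistance.Memory M)
          (A : CostDistance.SteinerTree I) (E : CostDistance.EdgeList A),
          CostDistance.Exec R P (CostDistance.Memory.initial I μ) k τ ∧
          k ≤ K * (R.time + I.numSinks) ∧
          τ.Holds A E ∧
          A.objective ≤
            (1 + (1609 * √1609 - 42427) / 34992 * μ) * R.tree.connectionCost +
              (1 + 1 / μ) * I.minDelay := by
  refine ⟨CostDistance.steinerProgram, 51, fun M _ I μ hμ β R => ?_⟩
  obtain ⟨A, E, ⟨k, τ, hk, he, hτ⟩, hobj⟩ := CostDistance.runs_steinerProgram R hμ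
  refine ⟨k, τ, A, E, he, hk.trans (by omega), hτ, hobj.trans ?_⟩
  -- The program achieves the factor `1 / 2` in place of `b`, and `b ≥ 1 / 2` as `40 ^ 2 ≤ 1609`.
  have hsqrt : (40 : ℝ) ≤ √1609 := Real.le_sqrt_of_sq_le (by norm_num)
  have hC : 0 ≤ R.tree.connectionCost :=
    Finset.sum_nonneg fun e _ => R.tree.edgeLength_nonneg e
  have hb : μ / 2 ≤ (1609 * √1609 - 42427) / 34992 * μ := by nlinarith
  have := mul_le_mul_of_nonneg_right hb hC
  linarith
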